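/- \textbf{Setting.} For a vector $v$ let $|v|_1,|v|_2,|v|_\infty$ be its $\ell_1$, $\ell_2$ and maximum norms; for a matrix $A$ let $|A|_\infty$ be the largest absolute value of its entries. For a real random variable $Z$ let $\|Z\|_{\Psi_\alpha}=\inf\{\eta>0:\mathbb E[\exp((|Z|/\eta)^\alpha)-1]\le 1\}$, and for a random vector $Z$ let $\|Z\|_{J,\Psi_\alpha}=\sup_{|\theta|_2=1}\|\theta^\top Z\|_{\Psi_\alpha}$. Let $p\ge 1$, $0<\alpha\le 2$, $a,\beta\in\mathbb R^p$, $\delta\ge 1$. Let $X$ be a random $n\times p$ matrix whose rows $X_{i,:}$ are i.i.d. with mean $0$ and positive definite covariance $\Sigma$, with largest and smallest eigenvalues $\lambda_{\max},\lambda_{\min}$. Let $Y=X\beta+\varepsilon$ with an arbitrary error vector $\varepsilon$, and let $\hat\beta^l$ be an arbitrary estimator of $\beta$ (for instance the Lasso). Put $S=X^\top X/n$ and $\hat\varepsilon=Y-X\hat\beta^l$. \emph{Covariates.} $\|\Sigma^{-1/2}X_{i,:}^\top\|_{J,\Psi_\alpha}\le\kappa$ and $\|X_{i,v}\|_{\Psi_\alpha}\le\kappa$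 for all $v$. With $i\ne j$ put $$\Gamma=\max\Big(\max_v\mathbb E[(a^\top\Sigma^{-1}X_{i,:}^\top X_{i,v})^2],\ \max_v\mathbb E[(a^\top\Sigma^{-1}X_{i,:}^\top X_{j,v})^2],\ \max_{u,v}\mathbb E[(X_{i,u}X_{i,v})^2]\Big).$$ \emph{Sample size.} With $\kappa^\star=\kappa^2\max(|a|_2\sqrt{\lambda_{\max}}/\sqrt{\lambda_{\min}},1)$, $$n>\max\Big\{\frac{4C_\alpha^2(\kappa^\star)^2[\log(2n)]^{4/\alpha}[3\log(pn)]^{4/\alpha-1}}{\Gamma},\ 64\,\Gamma(\log(pn)+2\log p)\Big\}.$$ \emph{Transformations.} $\mathcal G$ is a finite non-empty set of $n\times n$ matrices, contained in one of the following: (a) the matrices of the permutations $g$ of $[n]$ for which $[n]$ is a disjoint union of two sets $N_1,N_2$ of equal size with $g(N_1)\subseteq N_2$ and $g(N_2)\subseteq N_1$; (b) the diagonal matrices with diagonal entries $\pm1$ and as many $+1$ as $-1$; (c) for some partition of $[n]$ into clusters of equal size, the block diagonal matrices whose block for each cluster is a permutation matrix of the kind (a) on that cluster. \emph{Selection of $M^\star$.}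 For each $\lambda\in[0,1)$ for which the constraint is feasible, let $M_\lambda$ be a minimizer of $|a^\top M|_1$ over $M\in\mathbb R^{p\times p}$ subject to $|a^\top(I-MS)|_\infty\le\lambda$. Let $\lambda^\star$ minimize, over the $\lambda\in[0,1)$ for which the constraint is feasible, $$\delta\,|a^\top(I-M_\lambda S)|_\infty+\frac{|a^\top M_\lambda|_1}{|\mathcal G|}\sum_{G\in\mathcal G}\Big|\frac{X^\top GX}{n}\Big|_\infty ,$$ and put $M^\star=M_{\lambda^\star}$. \emph{Randomization distributions.} For $G$ uniform on $\mathcal G$, and with $X,\varepsilon,\hat\beta^l,M^\star$ held fixed, let $F_t(X,\varepsilon)$ (oracle) and $F_{\hat t}(X,\varepsilon)$ (attainable) be the distributions of $$t(G\varepsilon)=\sqrt n\,a^\top\Big[(I-M^\star S)(\hat\beta^l-\beta)+\tfrac1nM^\star X^\top G\varepsilon\Big],\qquad t(G\hat\varepsilon)=\tfrac1{\sqrt n}a^\top M^\star X^\top G\hat\varepsilon,$$ and let $d_1$ be the Wasserstein-1 distance. \textbf{Claim.} There are constants $C_\alpha>0$, depending only on $\alpha$, such that under the conditions above there is an event of probability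 greater than $1-\frac{3}{np}-\frac{6|\mathcal G|}{np}$ on which, for every $M^\star$ selected as described, $$d_1\big(F_t(X,\varepsilon),F_{\hat t}(X,\varepsilon)\big)\le|\hat\beta^l-\beta|_1\cdot 8\big(\delta+|a^\top\Sigma^{-1}|_1\big)\sqrt{2\Gamma(\log(pn)+2\log p)} .$$ -/

import Mathlib

open MeasureTheory ProbabilityTheory Matrix
open scoped ENNReal NNReal

namespace ResidualRandomization

noncomputable section

/-! Norms. On `Fin p → ℝ` the norm `‖v‖` is already the maximum norm. -/

/-- The `ℓ₁` norm of a vector. -/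
def l1 {p : ℕ} (v : Fin p → ℝ) : ℝ := ∑ i, |v i|

/-- The Euclidean norm of a vector. -/
def l2 {p : ℕ} (v : Fin p → ℝ) : ℝ := √(∑ i, v i ^ 2)

/-- The largest absolute value of an entry of a matrix. -/
def maxEntry {p : ℕ} (A : Matrix (Fin p) (Fin p) ℝ) : ℝ :=
  ⨆ uv : Fin p × Fin p, |A uv.1 uv.2|

/-! Sub-Weibull random variables. -/

/-- The Orlicz norm for `ψ_α x = exp (x ^ α) - 1`, that is
`inf {η > 0 | E ψ_α (|Z| / η) ≤ 1}`; it is `∞` if there is no such `η`. -/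
def orliczNorm {Ω : Type*} [MeasurableSpace Ω] (α : ℝ) (Z : Ω → ℝ) (μ : Measure Ω) : ℝ≥0∞ :=
  ⨅ (η : ℝ≥0) (_ : 0 < η)
    (_ : ∫⁻ ω, ENNReal.ofReal (Real.exp ((|Z ω| / η) ^ α) - 1) ∂μ ≤ 1), (η : ℝ≥0∞)

/-- The joint Orlicz norm of a random vector: the supremum of the Orlicz norms of its
one-dimensional projections in Euclidean unit directions. -/
def jointOrliczNorm {Ω : Type*} [MeasurableSpace Ω] {p : ℕ} (α : ℝ) (Z : Ω → Fin p → ℝ)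
    (μ : Measure Ω) : ℝ≥0∞ :=
  ⨆ (θ : Fin p → ℝ) (_ : l2 θ = 1), orliczNorm α (fun ω => θ ⬝ᵥ Z ω) μ

/-! The law `ν` of a row of the design matrix and its parameters. -/

/-- The covariance matrix `Σ` of the law `ν`. -/
def covMatrix {p : ℕ} (ν : Measure (Fin p → ℝ)) : Matrix (Fin p) (Fin p) ℝ :=
  Matrix.of fun u v => cov[fun x => x u, fun x => x v; ν]

/-- `A ^ (-1/2)` for a positive definite matrix `A`, by the functional calculus. -/
def invSqrt {p : ℕ} (A : Matrix (Fin p) (Fin p) ℝ) : Matrix (Fin p) (Fin p) ℝ :=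
  cfc (fun x : ℝ => (√x)⁻¹) A

/-- The largest eigenvalue of a symmetric matrix. -/
def maxEigenvalue {p : ℕ} (A : Matrix (Fin p) (Fin p) ℝ) : ℝ := sSup (spectrum ℝ A)

/-- The smallest eigenvalue of a symmetric matrix. -/
def minEigenvalue {p : ℕ} (A : Matrix (Fin p) (Fin p) ℝ) : ℝ := sInf (spectrum ℝ A)

/-- The condition on the covariates: mean zero, invertible covariance, sub-Weibull(`α`) entries
and jointly sub-Weibull(`α`) de-correlated rows, with all the norms at most `κ`. -/
structure CovariateCondition {p : ℕ} (ν : Measure (Fin p → ℝ)) (α : ℝ) (κ : ℝ≥0) : Prop where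
  mean_zero : ∀ v, ∫ x, x v ∂ν = 0
  posDef : (covMatrix ν).PosDef
  joint_le : jointOrliczNorm α (fun x : Fin p → ℝ => invSqrt (covMatrix ν) *ᵥ x) ν ≤ κ
  entry_le : ∀ v, orliczNorm α (fun x : Fin p → ℝ => x v) ν ≤ κ

/-- The constant `Γ`: the maximum of `max_v E (aᵀ Σ⁻¹ x x_v)²`, `max_v E (aᵀ Σ⁻¹ x y_v)²` and
`max_{u, v} E (x_u x_v)²`, where `x` and `y` are independent rows. -/
def Gam {p : ℕ} (ν : Measure (Fin p → ℝ)) (a : Fin p → ℝ) : ℝ :=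
  max (max
    (⨆ v : Fin p, ∫ x, ((a ᵥ* (covMatrix ν)⁻¹) ⬝ᵥ x * x v) ^ 2 ∂ν)
    (⨆ v : Fin p, ∫ z, ((a ᵥ* (covMatrix ν)⁻¹) ⬝ᵥ z.1 * z.2 v) ^ 2 ∂(ν.prod ν)))
    (⨆ uv : Fin p × Fin p, ∫ x, (x uv.1 * x uv.2) ^ 2 ∂ν)

/-- `κ⋆ = κ² max (|a|₂ √λ_max / √λ_min, 1)`. -/
def kappaStar {p : ℕ} (ν : Measure (Fin p → ℝ)) (a : Fin p → ℝ) (κ : ℝ≥0) : ℝ :=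
  (κ : ℝ) ^ 2 *
    max (l2 a * √(maxEigenvalue (covMatrix ν)) / √(minEigenvalue (covMatrix ν))) 1

/-- The sample size condition, with the constant `C` in the place of `C_α`. -/
def SampleSizeCondition {p : ℕ} (n : ℕ) (ν : Measure (Fin p → ℝ)) (a : Fin p → ℝ)
    (α : ℝ) (κ : ℝ≥0) (C : ℝ) : Prop :=
  (n : ℝ) > max
    (4 * C ^ 2 * kappaStar ν a κ ^ 2 * Real.log (2 * n) ^ (4 / α) *
      (3 * Real.log (p * n)) ^ (4 / α - 1) / Gam ν a)
    (64 * Gam ν a * (Real.log (p * n) + 2 * Real.log p))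

/-! The sets of transformations. -/

/-- `S` splits into two disjoint parts of equal size that `g` maps into each other. -/
def SwapsHalves {n : ℕ} (g : Equiv.Perm (Fin n)) (S : Finset (Fin n)) : Prop :=
  ∃ N₁ N₂ : Finset (Fin n), Disjoint N₁ N₂ ∧ N₁ ∪ N₂ = S ∧ N₁.card = N₂.card ∧
    (∀ j ∈ N₁, g j ∈ N₂) ∧ (∀ j ∈ N₂, g j ∈ N₁)

/-- Matrices of the permutations of `[n]` that exchange two halves of `[n]`. -/
def permSet (n : ℕ) : Set (Matrix (Fin n) (Fin n) ℝ) :=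
  {G | ∃ g : Equiv.Perm (Fin n), G = g.permMatrix ℝ ∧ SwapsHalves g Finset.univ}

/-- Diagonal matrices of signs with as many `1` as `-1`. -/
def signSet (n : ℕ) : Set (Matrix (Fin n) (Fin n) ℝ) :=
  {G | ∃ d : Fin n → ℝ, G = Matrix.diagonal d ∧ (∀ i, d i = 1 ∨ d i = -1) ∧
    {i | d i = 1}.ncard = {i | d i = -1}.ncard}

/-- Matrices, block diagonal for the clusters `L k`, each of whose diagonal blocks is the matrix
of a permutation of `L k` that exchanges two halves of `L k`. -/
def clusterSet {n nc : ℕ} (L : Fin nc → Finset (Fin n)) : Set (Matrix (Fin n) (Fin n) ℝ) :=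
  {G | ∃ g : Equiv.Perm (Fin n), G = g.permMatrix ℝ ∧ ∀ k, SwapsHalves g (L k)}

/-- The clusters are disjoint, of equal size, and cover `[n]`. -/
def IsClustering {n nc : ℕ} (L : Fin nc → Finset (Fin n)) : Prop :=
  (∀ k l, k ≠ l → Disjoint (L k) (L l)) ∧ (∀ i, ∃ k, i ∈ L k) ∧
    ∃ J : ℕ, ∀ k, (L k).card = J

/-- Exchangeability, sign symmetry or cluster exchangeability. -/
def GroupCondition {n : ℕ} (𝒢 : Finset (Matrix (Fin n) (Fin n) ℝ)) : Prop :=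
  (𝒢 : Set (Matrix (Fin n) (Fin n) ℝ)) ⊆ permSet n ∨
  (𝒢 : Set (Matrix (Fin n) (Fin n) ℝ)) ⊆ signSet n ∨
  ∃ (nc : ℕ) (L : Fin nc → Finset (Fin n)), IsClustering L ∧
    (𝒢 : Set (Matrix (Fin n) (Fin n) ℝ)) ⊆ clusterSet L

/-! The selection of `M`. -/

/-- The sample covariance matrix `S = Xᵀ X / n`. -/
def gram {n p : ℕ} (X : Matrix (Fin n) (Fin p) ℝ) : Matrix (Fin p) (Fin p) ℝ :=
  (1 / (n : ℝ)) • (Xᵀ * X)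

/-- The feasible set `{M | |aᵀ (I - M S)|_∞ ≤ lam}`. -/
def feasible {n p : ℕ} (X : Matrix (Fin n) (Fin p) ℝ) (a : Fin p → ℝ) (lam : ℝ) :
    Set (Matrix (Fin p) (Fin p) ℝ) :=
  {M | ‖a ᵥ* (1 - M * gram X)‖ ≤ lam}

/-- `M` minimizes `|aᵀ M|₁` over the feasible set. -/
def IsClimeSolution {n p : ℕ} (X : Matrix (Fin n) (Fin p) ℝ) (a : Fin p → ℝ) (lam : ℝ)
    (M : Matrix (Fin p) (Fin p) ℝ) : Prop :=
  M ∈ feasible X a lam ∧ ∀ M' ∈ feasible X a lam, l1 (a ᵥ* M) ≤ l1 (a ᵥ* M')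

/-- `δ |aᵀ (I - M S)|_∞ + |aᵀ M|₁ · avg_{G ∈ 𝒢} |Xᵀ G X / n|_∞`. -/
def objective {n p : ℕ} (X : Matrix (Fin n) (Fin p) ℝ) (a : Fin p → ℝ)
    (𝒢 : Finset (Matrix (Fin n) (Fin n) ℝ)) (δ : ℝ) (M : Matrix (Fin p) (Fin p) ℝ) : ℝ :=
  δ * ‖a ᵥ* (1 - M * gram X)‖ +
    l1 (a ᵥ* M) / 𝒢.card * ∑ G ∈ 𝒢, maxEntry ((1 / (n : ℝ)) • (Xᵀ * G * X))

/-- `M⋆ = M_{λ⋆}`, where `M_lam` solves the program with bound `lam` for each `lam` in `[0, 1)`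
for which that program is feasible, and `λ⋆` minimizes the objective of `M_lam` over these
`lam`. -/
def IsSelected {n p : ℕ} (X : Matrix (Fin n) (Fin p) ℝ) (a : Fin p → ℝ)
    (𝒢 : Finset (Matrix (Fin n) (Fin n) ℝ)) (δ : ℝ) (Mstar : Matrix (Fin p) (Fin p) ℝ) : Prop :=
  ∃ (M : ℝ → Matrix (Fin p) (Fin p) ℝ) (lamStar : ℝ),
    (∀ lam ∈ Set.Ico (0 : ℝ) 1, (feasible X a lam).Nonempty → IsClimeSolution X a lam (M lam)) ∧
    lamStar ∈ Set.Ico (0 : ℝ) 1 ∧ (feasible X a lamStar).Nonempty ∧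
    (∀ lam ∈ Set.Ico (0 : ℝ) 1, (feasible X a lam).Nonempty →
      objective X a 𝒢 δ (M lamStar) ≤ objective X a 𝒢 δ (M lam)) ∧
    Mstar = M lamStar

/-! The randomization distributions and their distance. -/

/-- The Wasserstein-1 distance: the infimum of the transport cost over all couplings. -/
def wasserstein1 (P Q : Measure ℝ) : ℝ≥0∞ :=
  ⨅ (π : Measure (ℝ × ℝ)) (_ : π.map Prod.fst = P ∧ π.map Prod.snd = Q),
    ∫⁻ z, ENNReal.ofReal |z.1 - z.2| ∂π

/-- `t(Gε) = √n aᵀ [(I - M S) (β̂ - β) + M Xᵀ G ε / n]`. -/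
def oracleStat {n p : ℕ} (X : Matrix (Fin n) (Fin p) ℝ) (a β βhat : Fin p → ℝ) (ε : Fin n → ℝ)
    (M : Matrix (Fin p) (Fin p) ℝ) (G : Matrix (Fin n) (Fin n) ℝ) : ℝ :=
  √n * (a ⬝ᵥ ((1 - M * gram X) *ᵥ (βhat - β) + (1 / (n : ℝ)) • ((M * Xᵀ * G) *ᵥ ε)))

/-- `t(Gε̂) = aᵀ M Xᵀ G ε̂ / √n` with the residuals `ε̂ = Y - X β̂`. -/
def attainableStat {n p : ℕ} (X : Matrix (Fin n) (Fin p) ℝ) (Y : Fin n → ℝ) (a βhat : Fin p → ℝ)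
    (M : Matrix (Fin p) (Fin p) ℝ) (G : Matrix (Fin n) (Fin n) ℝ) : ℝ :=
  1 / √n * (a ⬝ᵥ ((M * Xᵀ * G) *ᵥ (Y - X *ᵥ βhat)))

/-- The law of `t G` for `G` uniform on `𝒢`. -/
def randomizationDist {n : ℕ} (𝒢 : Finset (Matrix (Fin n) (Fin n) ℝ)) (h𝒢 : 𝒢.Nonempty)
    (t : Matrix (Fin n) (Fin n) ℝ → ℝ) : Measure ℝ :=
  ((PMF.uniformOfFinset 𝒢 h𝒢).map t).toMeasure

end

end ResidualRandomization

/-! ### A Bernstein inequality for sub-Weibull variables -/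

/-! Put Δ = β̂ - β. Since ε̂ = ε - XΔ, the two statistics at the same G differ by √n [aᵀ(I - MS)Δ +
aᵀM(XᵀGX/n)Δ], which Hölder bounds by √n |Δ|₁ (|aᵀ(I - MS)|_∞ + |aᵀM|₁ |XᵀGX/n|_∞). Coupling the two
distributions through a common G and using δ ≥ 1, d₁ is at most √n |Δ|₁ times the objective that M⋆
minimizes (`wasserstein1_le_objective`). By minimality M⋆ may be replaced by any M₀ with |aᵀ(I -
M₀S)|_∞ < 1 (`IsSelected.objective_le`); the choice is M₀ = Σ⁻¹.

It remains to show that |aᵀ(I - Σ⁻¹S)|_∞ and all |XᵀGX/n|_∞ are of order √(ΓL/n) with high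
probability, where L = log(pn) + 2 log p. Up to sign, the entries of the first are averages of
i.i.d. centred products. For a permutation g exchanging two halves, ∑ X_{iu} X_{g(i)v} splits into
sums over the halves; within a half the pairs (i, g(i)) are disjoint, so the summands are
independent and centred. For balanced signs the means cancel. Cluster permutations also exchange two
halves of [n].

A product of two sub-Weibull(α) variables has tails of order α/2. A truncated Bernstein inequality
(`measureReal_abs_sum_gt_lt`) bounds each sum, the first sample size condition making the variance
term dominate. Since e^{-L} = 1/(np³), a union bound over p + |𝒢|p² sums gives the stated
probability. -/

theorem exp_mul_trunc_le {q K B s l z w : ℝ} (hq : 1 ≤ q) (hK : 0 ≤ K) (hB : 0 < B) (hs : 0 < s)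
    (hl : 1 / 4 ≤ l) (hBl : 3 * l ≤ B) (hw : 0 ≤ w) (hz : |z| ≤ K * w ^ q)
    (hsB : s * K * B ^ (q - 1) * (8 * l) ≤ 1) :
    Real.exp (s * (if |z| ≤ K * B ^ q then z else 0)) ≤
      1 + s * z + s ^ 2 * z ^ 2 + 2 * Real.exp (-(3 * l)) * Real.exp w := by
  have hpos : 0 < 2 * Real.exp (-(3 * l)) * Real.exp w := by positivity
  -- On the truncation range one of the q powers of w can be kept and the others replaced by B,
  -- which makes z linear in w.
  have hzw : |z| ≤ K * B ^ q → |z| ≤ K * B ^ (q - 1) * w := by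
    intro h
    rcases le_total w B with hwB | hwB
    · rcases hw.eq_or_lt with rfl | hw0
      · rw [Real.zero_rpow (by linarith)] at hz; simpa using hz
      refine hz.trans ?_
      have : w ^ q = w ^ (q - 1) * w := by
        rw [← Real.rpow_add_one hw0.ne']; ring_nf
      rw [this, mul_assoc]
      gcongr
    · refine h.trans ?_
      have : B ^ q = B ^ (q - 1) * B := by
        rw [← Real.rpow_add_one hB.ne']; ring_nf
      rw [this, mul_assoc]
      gcongr
  split_ifs with h
  · rcases le_or_gt |s * z| 1 with h1 | h1
    · have := (abs_le.1 (Real.abs_exp_sub_one_sub_id_le h1)).2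
      nlinarith
    · have h2 : |s * z| * (8 * l) ≤ w := by
        rw [abs_mul, abs_of_pos hs]
        calc s * |z| * (8 * l) ≤ s * (K * B ^ (q - 1) * w) * (8 * l) := by gcongr; exact hzw h
          _ = (s * K * B ^ (q - 1) * (8 * l)) * w := by ring
          _ ≤ 1 * w := by gcongr
          _ = w := one_mul w
      -- From w ≥ 8l|sz| and |sz| > 1: w - |sz| - 3l ≥ (8l - 1) - 3l ≥ 0, as l ≥ 1/4.
      have h3 : |s * z| ≤ w - 3 * l := by nlinarith
      have h4 : Real.exp |s * z| ≤ Real.exp (-(3 * l)) * Real.exp w := by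
        rw [← Real.exp_add]; exact Real.exp_le_exp.2 (by linarith)
      have h5 := Real.exp_le_exp.2 (le_abs_self (s * z))
      have h6 := Real.add_one_le_exp |s * z|
      have h7 := neg_abs_le (s * z)
      nlinarith [sq_nonneg (s * z)]
  · have hwB : B < w := by
      by_contra! hc
      exact h (hz.trans (by gcongr))
    have h4 : 1 ≤ Real.exp (-(3 * l)) * Real.exp w := by
      rw [← Real.exp_add]; exact Real.one_le_exp (by linarith)
    simp only [mul_zero, Real.exp_zero]
    nlinarith [sq_nonneg (s * z + 1 / 2)]

/-- The pointwise bound keeps the untruncated z in its linear term, so E Z = 0 applies directly and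
the truncated variable needs no recentring. The bias of truncation sits in the term with exp(-3l).
-/
theorem mgf_trunc_le {Ω : Type*} [MeasurableSpace Ω] {μ : Measure Ω} [IsProbabilityMeasure μ]
    {Z W : Ω → ℝ} {q K B s l Γ : ℝ} (hq : 1 ≤ q) (hK : 0 ≤ K) (hB : 0 < B) (hs : 0 < s)
    (hl : 1 / 4 ≤ l) (hBl : 3 * l ≤ B) (hW0 : ∀ ω, 0 ≤ W ω)
    (hWi : Integrable (fun ω => Real.exp (W ω)) μ) (hWE : ∫ ω, Real.exp (W ω) ∂μ ≤ 6)
    (hZW : ∀ ω, |Z ω| ≤ K * W ω ^ q) (hZi : Integrable Z μ) (hZ0 : ∫ ω, Z ω ∂μ = 0)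
    (hZi2 : Integrable (fun ω => Z ω ^ 2) μ) (hZ2 : ∫ ω, Z ω ^ 2 ∂μ ≤ Γ)
    (hsB : s * K * B ^ (q - 1) * (8 * l) ≤ 1) :
    mgf (fun ω => if |Z ω| ≤ K * B ^ q then Z ω else 0) μ s ≤
      Real.exp (s ^ 2 * Γ + 12 * Real.exp (-(3 * l))) := by
  have hint : Integrable (fun ω => 1 + s * Z ω + s ^ 2 * Z ω ^ 2 +
      2 * Real.exp (-(3 * l)) * Real.exp (W ω)) μ :=
    (((integrable_const _).add (hZi.const_mul _)).add (hZi2.const_mul _)).add (hWi.const_mul _)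
  calc mgf (fun ω => if |Z ω| ≤ K * B ^ q then Z ω else 0) μ s
      ≤ ∫ ω, (1 + s * Z ω + s ^ 2 * Z ω ^ 2 + 2 * Real.exp (-(3 * l)) * Real.exp (W ω)) ∂μ := by
        refine integral_mono_of_nonneg (ae_of_all _ fun ω => (Real.exp_pos _).le) hint
          (ae_of_all _ fun ω => ?_)
        exact exp_mul_trunc_le hq hK hB hs hl hBl (hW0 ω) (hZW ω) hsB
    _ = 1 + s ^ 2 * ∫ ω, Z ω ^ 2 ∂μ + 2 * Real.exp (-(3 * l)) * ∫ ω, Real.exp (W ω) ∂μ := by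
        have i1 : Integrable (fun ω => 1 + s * Z ω) μ := (integrable_const _).add (hZi.const_mul _)
        have i2 : Integrable (fun ω => 1 + s * Z ω + s ^ 2 * Z ω ^ 2) μ :=
          i1.add (hZi2.const_mul _)
        rw [integral_add i2 (hWi.const_mul _), integral_add i1 (hZi2.const_mul _),
          integral_add (integrable_const _) (hZi.const_mul _),
          integral_const_mul, integral_const_mul, integral_const_mul, hZ0]
        simp
    _ ≤ (s ^ 2 * Γ + 12 * Real.exp (-(3 * l))) + 1 := by
        have := Real.exp_pos (-(3 * l))
        nlinarith [mul_le_mul_of_nonneg_left hZ2 (sq_nonneg s)]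
    _ ≤ _ := Real.add_one_le_exp _

theorem measureReal_sum_trunc_ge_le {Ω ι : Type*} [Fintype ι] [MeasurableSpace Ω] {μ : Measure Ω}
    [IsProbabilityMeasure μ] {Z W : ι → Ω → ℝ} {q K B s l Γ : ℝ} (hind : iIndepFun Z μ)
    (hZm : ∀ i, Measurable (Z i)) (hq : 1 ≤ q) (hK : 0 ≤ K) (hB : 0 < B) (hs : 0 < s)
    (hl : 1 / 4 ≤ l) (hBl : 3 * l ≤ B) (hW0 : ∀ i ω, 0 ≤ W i ω)
    (hWi : ∀ i, Integrable (fun ω => Real.exp (W i ω)) μ)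
    (hWE : ∀ i, ∫ ω, Real.exp (W i ω) ∂μ ≤ 6)
    (hZW : ∀ i ω, |Z i ω| ≤ K * W i ω ^ q) (hZi : ∀ i, Integrable (Z i) μ)
    (hZ0 : ∀ i, ∫ ω, Z i ω ∂μ = 0) (hZi2 : ∀ i, Integrable (fun ω => Z i ω ^ 2) μ)
    (hZ2 : ∀ i, ∫ ω, Z i ω ^ 2 ∂μ ≤ Γ) (hsB : s * K * B ^ (q - 1) * (8 * l) ≤ 1) (t : ℝ) :
    μ.real {ω | t ≤ ∑ i, if |Z i ω| ≤ K * B ^ q then Z i ω else 0} ≤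
      Real.exp (-s * t + Fintype.card ι * (s ^ 2 * Γ + 12 * Real.exp (-(3 * l)))) := by
  set T : ι → Ω → ℝ := fun i ω => if |Z i ω| ≤ K * B ^ q then Z i ω else 0 with hT
  have htr : Measurable fun x : ℝ => if |x| ≤ K * B ^ q then x else 0 :=
    Measurable.ite (measurableSet_le measurable_id.abs measurable_const) measurable_id
      measurable_const
  have hTm : ∀ i, Measurable (T i) := fun i => htr.comp (hZm i)
  have hTind : iIndepFun T μ := hind.comp (fun _ x => if |x| ≤ K * B ^ q then x else 0)
    fun _ => htr
  have hTb : ∀ i ω, |T i ω| ≤ K * B ^ q := by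
    intro i ω
    simp only [hT]
    split_ifs with h
    · exact h
    · simp; positivity
  have hint : Integrable (fun ω => Real.exp (s * (∑ i, T i) ω)) μ := by
    refine Integrable.of_bound (C := Real.exp (s * ∑ i : ι, K * B ^ q)) ?_ (ae_of_all _ fun ω => ?_)
    · have : Measurable (∑ i, T i) := by
        simpa only [← Finset.sum_apply] using
          Finset.measurable_sum (Finset.univ : Finset ι) fun i _ => hTm i
      exact (Real.measurable_exp.comp (this.const_mul s)).aestronglyMeasurable
    · rw [Real.norm_eq_abs, Real.abs_exp]
      refine Real.exp_le_exp.2 (mul_le_mul_of_nonneg_left ?_ hs.le)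
      rw [Finset.sum_apply]
      exact Finset.sum_le_sum fun i _ => (le_abs_self _).trans (hTb i ω)
  have h1 := measure_ge_le_exp_mul_mgf (μ := μ) (X := ∑ i, T i) t hs.le hint
  rw [hTind.mgf_sum hTm] at h1
  simp only [Finset.sum_apply] at h1
  refine h1.trans ?_
  rw [Real.exp_add]
  refine mul_le_mul_of_nonneg_left ?_ (Real.exp_pos _).le
  calc ∏ i, mgf (T i) μ s ≤ ∏ _i : ι, Real.exp (s ^ 2 * Γ + 12 * Real.exp (-(3 * l))) :=
        Finset.prod_le_prod (fun _ _ => mgf_nonneg) fun i _ =>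
          mgf_trunc_le hq hK hB hs hl hBl (hW0 i) (hWi i) (hWE i) (hZW i) (hZi i) (hZ0 i)
            (hZi2 i) (hZ2 i) hsB
    _ = _ := by rw [Finset.prod_const, ← Real.exp_nat_mul, Finset.card_univ]

/-- A Bernstein inequality for independent centred variables dominated by `K * W ^ q`, where `W`
has an exponential moment. -/
theorem measureReal_abs_sum_gt_lt {Ω ι : Type*} [Fintype ι] [MeasurableSpace Ω] {μ : Measure Ω}
    [IsProbabilityMeasure μ] {Z W : ι → Ω → ℝ} {q K Γ L V : ℝ} {n : ℕ} (hind : iIndepFun Z μ)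
    (hZm : ∀ i, Measurable (Z i)) (hq : 1 ≤ q) (hK : 0 ≤ K) (hW0 : ∀ i ω, 0 ≤ W i ω)
    (hWi : ∀ i, Integrable (fun ω => Real.exp (W i ω)) μ)
    (hWE : ∀ i, ∫ ω, Real.exp (W i ω) ∂μ ≤ 6)
    (hZW : ∀ i ω, |Z i ω| ≤ K * W i ω ^ q) (hZi : ∀ i, Integrable (Z i) μ)
    (hZ0 : ∀ i, ∫ ω, Z i ω ∂μ = 0) (hZi2 : ∀ i, Integrable (fun ω => Z i ω ^ 2) μ)
    (hZ2 : ∀ i, ∫ ω, Z i ω ^ 2 ∂μ ≤ Γ) (hn : 1 ≤ n) (hcard : Fintype.card ι ≤ n) (hL : 1 ≤ L)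
    (hV : 0 < V) (hVar : Fintype.card ι * Γ * L ≤ V ^ 2)
    (hR : 8 * 5 ^ q * K * Real.log (2 * n) ^ q * L ^ q ≤ V) :
    μ.real {ω | 8 * V < |∑ i, Z i ω|} < 3 * Real.exp (-L) := by
  set l := Real.log (2 * n) with hl_def
  have hn1 : (1 : ℝ) ≤ n := by exact_mod_cast hn
  have hl : 69 / 100 ≤ l := by
    have h1 : Real.log 2 ≤ l := Real.log_le_log (by norm_num) (by linarith)
    linarith [Real.log_two_gt_d9]
  have hexpl : Real.exp (-(3 * l)) ≤ 1 / (8 * n) := by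
    have h1 : Real.exp (-(3 * l)) = ((2 * n : ℝ) ^ 3)⁻¹ := by
      rw [Real.exp_neg, hl_def, show (3 : ℝ) = ((3 : ℕ) : ℝ) by norm_num, Real.exp_nat_mul,
        Real.exp_log (by linarith)]
    rw [h1, ← one_div]
    refine one_div_le_one_div_of_le (by linarith) ?_
    nlinarith [mul_self_nonneg ((n : ℝ) - 1)]
  -- With l = log(2n), e^{-B} = e^{-L}/(8n³): the truncation level is exceeded by none of the n
  -- variables, up to a probability of order e^{-L}.
  set B := L + 3 * l with hB_def
  have hB : 0 < B := by linarith
  set s := L / V with hs_def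
  have hs : 0 < s := by positivity
  have hcardn : (Fintype.card ι : ℝ) ≤ n := by exact_mod_cast hcard
  have hsB : s * K * B ^ (q - 1) * (8 * l) ≤ 1 := by
    -- Source of the factor 5^q in the tail condition; it uses L ≥ 1 and l ≥ 1/2.
    have hBle : B ≤ 5 * (L * l) := by nlinarith
    have h1 : B ^ (q - 1) ≤ (5 * (L * l)) ^ (q - 1) :=
      Real.rpow_le_rpow hB.le hBle (by linarith)
    have h2 : (5 * (L * l)) ^ (q - 1) * (5 * (L * l)) = 5 ^ q * (L ^ q * l ^ q) := by
      rw [← Real.rpow_add_one (by positivity), sub_add_cancel, Real.mul_rpow (by norm_num)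
        (by positivity), Real.mul_rpow (by linarith) (by linarith)]
    calc s * K * B ^ (q - 1) * (8 * l) ≤ s * K * (5 * (L * l)) ^ (q - 1) * (8 * l) := by gcongr
      _ = (8 * K * ((5 * (L * l)) ^ (q - 1) * (5 * (L * l))) / 5) / V := by
          rw [hs_def]; field_simp
      _ = ((8 * 5 ^ q * K * l ^ q * L ^ q) / 5) / V := by rw [h2]; ring
      _ ≤ V / V := by gcongr; linarith
      _ = 1 := div_self hV.ne'
  -- The exponent is at most -8L + L + 3/2, because s V = L.
  have hexp : -s * (8 * V) + Fintype.card ι * (s ^ 2 * Γ + 12 * Real.exp (-(3 * l))) ≤ -L := by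
    have h1 : s * V = L := by rw [hs_def]; field_simp
    have h2 : Fintype.card ι * (s ^ 2 * Γ) ≤ L := by
      have : Fintype.card ι * (s ^ 2 * Γ) = (Fintype.card ι * Γ * L) * (L / V ^ 2) := by
        rw [hs_def]; field_simp
      rw [this]
      calc (Fintype.card ι * Γ * L) * (L / V ^ 2) ≤ V ^ 2 * (L / V ^ 2) := by gcongr
        _ = L := by field_simp
    have h3 : Fintype.card ι * (12 * Real.exp (-(3 * l))) ≤ 12 / 8 := by
      calc Fintype.card ι * (12 * Real.exp (-(3 * l))) ≤ n * (12 * (1 / (8 * n))) := by gcongr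
        _ = 12 / 8 := by field_simp
    linarith
  have htail : ∀ Z' : ι → Ω → ℝ, iIndepFun Z' μ → (∀ i, Measurable (Z' i)) →
      (∀ i ω, |Z' i ω| = |Z i ω|) → (∀ i, ∫ ω, Z' i ω ∂μ = 0) →
      μ.real {ω | 8 * V ≤ ∑ i, if |Z' i ω| ≤ K * B ^ q then Z' i ω else 0} ≤ Real.exp (-L) := by
    intro Z' hi hm ha h0
    have hsq : ∀ i, (fun ω => Z' i ω ^ 2) = fun ω => Z i ω ^ 2 := fun i => by
      funext ω; rw [← sq_abs, ha, sq_abs]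
    refine (measureReal_sum_trunc_ge_le (Γ := Γ) hi hm hq hK hB hs (by linarith)
      (by linarith : 3 * l ≤ B) hW0 hWi
      hWE (fun i ω => by rw [ha]; exact hZW i ω)
      (fun i => (hZi i).congr' (hm i).aestronglyMeasurable
        (ae_of_all _ fun ω => by simp [ha])) h0 (fun i => by rw [hsq]; exact hZi2 i)
      (fun i => by rw [hsq]; exact hZ2 i) hsB _).trans (Real.exp_le_exp.2 hexp)
  have hpos := htail Z hind hZm (fun _ _ => rfl) hZ0
  have hneg := htail (fun i ω => -Z i ω) (hind.comp (fun _ x => -x) fun _ => measurable_neg)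
    (fun i => (hZm i).neg) (fun _ _ => abs_neg _) (fun i => by rw [integral_neg, hZ0, neg_zero])
  have hbig : ∀ i, μ.real {ω | K * B ^ q < |Z i ω|} ≤ 6 / (8 * n) * Real.exp (-L) := by
    intro i
    have hsub : {ω | K * B ^ q < |Z i ω|} ⊆ {ω | Real.exp B ≤ Real.exp (W i ω)} := by
      intro ω hω
      simp only [Set.mem_ofPred_eq] at hω ⊢
      by_contra! hc
      have hc' := Real.exp_lt_exp.1 hc
      have h1 : K * W i ω ^ q ≤ K * B ^ q := by have := hW0 i ω; gcongr
      linarith [hZW i ω]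
    have h1 := mul_meas_ge_le_integral_of_nonneg (ae_of_all _ fun ω => (Real.exp_pos (W i ω)).le)
      (hWi i) (Real.exp B)
    have h2 : μ.real {ω | Real.exp B ≤ Real.exp (W i ω)} ≤ 6 * Real.exp (-B) := by
      rw [Real.exp_neg, ← div_eq_mul_inv, le_div_iff₀ (Real.exp_pos B), mul_comm]
      exact h1.trans (hWE i)
    refine (measureReal_mono hsub).trans (h2.trans ?_)
    have : Real.exp (-B) = Real.exp (-(3 * l)) * Real.exp (-L) := by
      rw [← Real.exp_add]; congr 1; rw [hB_def]; ring
    rw [this, ← mul_assoc]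
    refine mul_le_mul_of_nonneg_right ?_ (Real.exp_pos _).le
    calc 6 * Real.exp (-(3 * l)) ≤ 6 * (1 / (8 * n)) := by gcongr
      _ = _ := by ring
  have hcover : {ω | 8 * V < |∑ i, Z i ω|} ⊆
      ({ω | 8 * V ≤ ∑ i, if |Z i ω| ≤ K * B ^ q then Z i ω else 0} ∪
       {ω | 8 * V ≤ ∑ i, if |-Z i ω| ≤ K * B ^ q then -Z i ω else 0}) ∪
      ⋃ i ∈ (Finset.univ : Finset ι), {ω | K * B ^ q < |Z i ω|} := by
    intro ω hω
    by_cases h : ∃ i, K * B ^ q < |Z i ω|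
    · right; simpa using h
    · push Not at h
      left
      simp only [Set.mem_union, Set.mem_ofPred_eq] at hω ⊢
      simp only [abs_neg, h, if_true, Finset.sum_neg_distrib]
      rcases lt_abs.1 hω with h' | h'
      · exact Or.inl h'.le
      · exact Or.inr h'.le
  have hun : μ.real (⋃ i ∈ (Finset.univ : Finset ι), {ω | K * B ^ q < |Z i ω|}) ≤
      6 / 8 * Real.exp (-L) := by
    refine (measureReal_biUnion_finset_le _ _).trans ?_
    calc ∑ i, μ.real {ω | K * B ^ q < |Z i ω|} ≤ ∑ _i : ι, 6 / (8 * n) * Real.exp (-L) :=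
          Finset.sum_le_sum fun i _ => hbig i
      _ = Fintype.card ι * (6 / (8 * n) * Real.exp (-L)) := by
          rw [Finset.sum_const, Finset.card_univ, nsmul_eq_mul]
      _ ≤ n * (6 / (8 * n) * Real.exp (-L)) := by gcongr
      _ = _ := by field_simp
  -- Two tails of the truncated sum and the truncation event give (1 + 1 + 6/8) e^{-L}, strictly
  -- below 3 e^{-L}.
  have h := (measureReal_mono (μ := μ) hcover).trans ((measureReal_union_le _ _).trans
    (add_le_add_left (measureReal_union_le _ _) _))
  have := Real.exp_pos (-L)
  linarith

/-! ### Orlicz norms and products of sub-Weibull variables -/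

/-- `E exp ((|Z| / η) ^ α) ≤ 2`. -/
def IsSubWeibull {Ω : Type*} [MeasurableSpace Ω] (α η : ℝ) (Z : Ω → ℝ) (μ : Measure Ω) : Prop :=
  Integrable (fun ω => Real.exp ((|Z ω| / η) ^ α)) μ ∧
    ∫ ω, Real.exp ((|Z ω| / η) ^ α) ∂μ ≤ 2

/-- The strict inequality spares a discussion of whether the infimum is attained; later uses pay for
it with 2κ in place of κ. -/
theorem isSubWeibull_of_orliczNorm_lt {Ω : Type*} [MeasurableSpace Ω] {μ : Measure Ω}
    [IsProbabilityMeasure μ] {α : ℝ} (hα : 0 < α) {Z : Ω → ℝ} (hZ : Measurable Z) {η : ℝ≥0}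
    (h : ResidualRandomization.orliczNorm α Z μ < η) : IsSubWeibull α η Z μ := by
  simp only [ResidualRandomization.orliczNorm, iInf_lt_iff] at h
  obtain ⟨η', h0, hE, hlt⟩ := h
  have hlt' : η' < η := by exact_mod_cast hlt
  have h0' : (0 : ℝ) < η' := by exact_mod_cast h0
  have hle : ∀ ω, Real.exp ((|Z ω| / η) ^ α) ≤ Real.exp ((|Z ω| / η') ^ α) := by
    intro ω
    refine Real.exp_le_exp.2 (Real.rpow_le_rpow (by positivity) ?_ hα.le)
    exact div_le_div_of_nonneg_left (abs_nonneg _) h0' (by exact_mod_cast hlt'.le)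
  have hm : Measurable fun ω => Real.exp ((|Z ω| / η) ^ α) :=
    Real.measurable_exp.comp ((hZ.abs.div_const _).pow_const _)
  have hnn : ∀ ω, 0 ≤ Real.exp ((|Z ω| / η) ^ α) - 1 := fun ω =>
    sub_nonneg.2 (Real.one_le_exp (by positivity))
  have hlin : ∫⁻ ω, ENNReal.ofReal (Real.exp ((|Z ω| / η) ^ α) - 1) ∂μ ≤ 1 :=
    (lintegral_mono fun ω => ENNReal.ofReal_le_ofReal (sub_le_sub_right (hle ω) 1)).trans hE
  have hint : Integrable (fun ω => Real.exp ((|Z ω| / η) ^ α) - 1) μ := by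
    refine ⟨(hm.sub_const 1).aestronglyMeasurable, ?_⟩
    rw [hasFiniteIntegral_iff_ofReal (ae_of_all _ hnn)]
    exact hlin.trans_lt ENNReal.one_lt_top
  have hint' : Integrable (fun ω => Real.exp ((|Z ω| / η) ^ α)) μ := by
    simpa [Pi.add_def] using hint.add (integrable_const (1 : ℝ))
  refine ⟨hint', ?_⟩
  have h1 : ∫ ω, (Real.exp ((|Z ω| / η) ^ α) - 1) ∂μ ≤ 1 := by
    rw [integral_eq_lintegral_of_nonneg_ae (ae_of_all _ hnn) hint.aestronglyMeasurable]
    exact ENNReal.toReal_le_of_le_ofReal zero_le_one (by simpa using hlin)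
  rw [integral_sub hint' (integrable_const _)] at h1
  simp at h1
  linarith

theorem IsSubWeibull.comp {Ω Ω' : Type*} [MeasurableSpace Ω] [MeasurableSpace Ω'] {μ : Measure Ω}
    {ν : Measure Ω'} {α η : ℝ} {Z : Ω' → ℝ} {f : Ω → Ω'} (hf : MeasurePreserving f μ ν)
    (h : IsSubWeibull α η Z ν) : IsSubWeibull α η (fun ω => Z (f ω)) μ := by
  refine ⟨hf.integrable_comp_of_integrable h.1, ?_⟩
  have h1 : AEStronglyMeasurable (fun ω => Real.exp ((|Z ω| / η) ^ α)) (μ.map f) := by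
    rw [hf.map_eq]; exact h.1.aestronglyMeasurable
  have := integral_map hf.measurable.aemeasurable h1
  rw [hf.map_eq] at this
  rw [← this]
  exact h.2

theorem rpow_le_exp_sq_mul_exp {r w : ℝ} (hr : 0 < r) (hw : 0 ≤ w) :
    w ^ r ≤ Real.exp (r ^ 2) * Real.exp w := by
  have h1 : w ≤ r * Real.exp (w / r) := by
    have := Real.add_one_le_exp (w / r)
    have h2 : w / r ≤ Real.exp (w / r) := by linarith
    rwa [div_le_iff₀ hr, mul_comm] at h2
  have h2 : r ≤ Real.exp r := by linarith [Real.add_one_le_exp r]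
  have h3 : w ≤ Real.exp (r + w / r) := by
    rw [Real.exp_add]
    exact h1.trans (mul_le_mul_of_nonneg_right h2 (Real.exp_pos _).le)
  calc w ^ r ≤ Real.exp (r + w / r) ^ r := Real.rpow_le_rpow hw h3 hr.le
    _ = Real.exp (r ^ 2) * Real.exp w := by
      rw [← Real.exp_mul, ← Real.exp_add]; congr 1; field_simp

/-- AM-GM for the powers x^{α/2}, y^{α/2}. The exponent q = 2/α of all the tail bounds comes from
here. -/
theorem abs_mul_le_mul_rpow {α η₁ η₂ : ℝ} (hα : 0 < α) (h₁ : 0 < η₁) (h₂ : 0 < η₂) (u v : ℝ) :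
    |u * v| ≤ η₁ * η₂ * (((|u| / η₁) ^ α + (|v| / η₂) ^ α) / 2) ^ (2 / α) := by
  set x := |u| / η₁
  set y := |v| / η₂
  have hx : 0 ≤ x := by positivity
  have hy : 0 ≤ y := by positivity
  have h : x * y ≤ ((x ^ α + y ^ α) / 2) ^ (2 / α) := by
    have hsq : ∀ z : ℝ, 0 ≤ z → (z ^ (α / 2)) ^ 2 = z ^ α := fun z hz => by
      rw [← Real.rpow_natCast, ← Real.rpow_mul hz]; congr 1; push_cast; ring
    have h1 : (x * y) ^ (α / 2) ≤ (x ^ α + y ^ α) / 2 := by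
      rw [Real.mul_rpow hx hy, ← hsq x hx, ← hsq y hy]
      nlinarith [sq_nonneg (x ^ (α / 2) - y ^ (α / 2))]
    calc x * y = ((x * y) ^ (α / 2)) ^ (2 / α) := by
          rw [← Real.rpow_mul (by positivity), div_mul_div_cancel₀ two_ne_zero, div_self hα.ne',
            Real.rpow_one]
      _ ≤ _ := Real.rpow_le_rpow (by positivity) h1 (by positivity)
  calc |u * v| = η₁ * η₂ * (x * y) := by
        rw [abs_mul]; simp only [x, y]; field_simp
    _ ≤ _ := by gcongr

/-- A centred variable with second moment at most `Γ`, dominated by `K * W ^ q` for some `W` with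
an exponential moment. -/
def IsTailDominated {Ω : Type*} [MeasurableSpace Ω] (q K Γ : ℝ) (Z : Ω → ℝ) (μ : Measure Ω) :
    Prop :=
  Measurable Z ∧ Integrable Z μ ∧ ∫ ω, Z ω ∂μ = 0 ∧ Integrable (fun ω => Z ω ^ 2) μ ∧
    ∫ ω, Z ω ^ 2 ∂μ ≤ Γ ∧
    ∃ W : Ω → ℝ, (∀ ω, 0 ≤ W ω) ∧ Integrable (fun ω => Real.exp (W ω)) μ ∧
      ∫ ω, Real.exp (W ω) ∂μ ≤ 6 ∧ ∀ ω, |Z ω| ≤ K * W ω ^ q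

/-- AM-GM for exponentials, so no independence of U and V is needed. -/
theorem IsSubWeibull.exp_half_add {Ω : Type*} [MeasurableSpace Ω] {μ : Measure Ω} {α η₁ η₂ : ℝ}
    {U V : Ω → ℝ} (hU : IsSubWeibull α η₁ U μ) (hV : IsSubWeibull α η₂ V μ) :
    Integrable (fun ω => Real.exp (((|U ω| / η₁) ^ α + (|V ω| / η₂) ^ α) / 2)) μ ∧
      ∫ ω, Real.exp (((|U ω| / η₁) ^ α + (|V ω| / η₂) ^ α) / 2) ∂μ ≤ 2 := by
  have hle : ∀ ω, Real.exp (((|U ω| / η₁) ^ α + (|V ω| / η₂) ^ α) / 2) ≤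
      (Real.exp ((|U ω| / η₁) ^ α) + Real.exp ((|V ω| / η₂) ^ α)) / 2 := by
    intro ω
    have hsq : ∀ z : ℝ, Real.exp (z / 2) ^ 2 = Real.exp z := fun z => by
      rw [← Real.exp_nat_mul]; congr 1; push_cast; ring
    rw [add_div, Real.exp_add, ← hsq ((|U ω| / η₁) ^ α), ← hsq ((|V ω| / η₂) ^ α)]
    nlinarith [sq_nonneg (Real.exp ((|U ω| / η₁) ^ α / 2) - Real.exp ((|V ω| / η₂) ^ α / 2))]
  have hlog : ∀ (η : ℝ) (Z : Ω → ℝ), IsSubWeibull α η Z μ →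
      AEStronglyMeasurable (fun ω => (|Z ω| / η) ^ α) μ := fun η Z h => by
    have := (Real.measurable_log.comp_aemeasurable h.1.aestronglyMeasurable.aemeasurable)
    simpa [Function.comp_def] using this.aestronglyMeasurable
  have hg : Integrable (fun ω =>
      (Real.exp ((|U ω| / η₁) ^ α) + Real.exp ((|V ω| / η₂) ^ α)) / 2) μ :=
    (hU.1.add hV.1).div_const 2
  have hint : Integrable (fun ω => Real.exp (((|U ω| / η₁) ^ α + (|V ω| / η₂) ^ α) / 2)) μ := by
    refine hg.mono' ?_ (ae_of_all _ fun ω => ?_)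
    · have := ((hlog _ _ hU).add (hlog _ _ hV)).aemeasurable.div_const 2
      exact (Real.measurable_exp.comp_aemeasurable this).aestronglyMeasurable
    · rw [Real.norm_eq_abs, Real.abs_exp]; exact hle ω
  refine ⟨hint, (integral_mono hint hg hle).trans ?_⟩
  rw [integral_div, integral_add hU.1 hV.1]
  linarith [hU.2, hV.2]

theorem IsSubWeibull.integrable_abs_mul_rpow {Ω : Type*} [MeasurableSpace Ω] {μ : Measure Ω}
    [IsProbabilityMeasure μ] {α η₁ η₂ r : ℝ} (hα : 0 < α) (h₁ : 0 < η₁) (h₂ : 0 < η₂) (hr : 0 < r)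
    {U V : Ω → ℝ} (hUm : Measurable U) (hVm : Measurable V) (hU : IsSubWeibull α η₁ U μ)
    (hV : IsSubWeibull α η₂ V μ) :
    Integrable (fun ω => |U ω * V ω| ^ r) μ ∧
      ∫ ω, |U ω * V ω| ^ r ∂μ ≤ 2 * (η₁ * η₂) ^ r * Real.exp ((2 / α * r) ^ 2) := by
  obtain ⟨hWi, hWE⟩ := hU.exp_half_add hV
  set W : Ω → ℝ := fun ω => ((|U ω| / η₁) ^ α + (|V ω| / η₂) ^ α) / 2
  have hW0 : ∀ ω, 0 ≤ W ω := fun ω => by simp only [W]; positivity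
  have hle : ∀ ω, |U ω * V ω| ^ r ≤
      ((η₁ * η₂) ^ r * Real.exp ((2 / α * r) ^ 2)) * Real.exp (W ω) := by
    intro ω
    calc |U ω * V ω| ^ r ≤ (η₁ * η₂ * W ω ^ (2 / α)) ^ r :=
          Real.rpow_le_rpow (abs_nonneg _) (abs_mul_le_mul_rpow hα h₁ h₂ _ _) hr.le
      _ = (η₁ * η₂) ^ r * W ω ^ (2 / α * r) := by
          rw [Real.mul_rpow (by positivity) (Real.rpow_nonneg (hW0 ω) _),
            ← Real.rpow_mul (hW0 ω)]
      _ ≤ (η₁ * η₂) ^ r * (Real.exp ((2 / α * r) ^ 2) * Real.exp (W ω)) := by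
          gcongr
          exact rpow_le_exp_sq_mul_exp (by positivity) (hW0 ω)
      _ = _ := by ring
  have hg := hWi.const_mul ((η₁ * η₂) ^ r * Real.exp ((2 / α * r) ^ 2))
  have hint : Integrable (fun ω => |U ω * V ω| ^ r) μ := by
    refine hg.mono' ((hUm.mul hVm).abs.pow_const r).aestronglyMeasurable (ae_of_all _ fun ω => ?_)
    rw [Real.norm_eq_abs, abs_of_nonneg (by positivity)]
    exact hle ω
  refine ⟨hint, (integral_mono hint hg hle).trans ?_⟩
  rw [integral_const_mul]
  have : 0 ≤ (η₁ * η₂) ^ r * Real.exp ((2 / α * r) ^ 2) := by positivity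
  nlinarith

theorem IsSubWeibull.integrable_mul {Ω : Type*} [MeasurableSpace Ω] {μ : Measure Ω}
    [IsProbabilityMeasure μ] {α η₁ η₂ : ℝ} (hα : 0 < α) (h₁ : 0 < η₁) (h₂ : 0 < η₂)
    {U V : Ω → ℝ} (hUm : Measurable U) (hVm : Measurable V) (hU : IsSubWeibull α η₁ U μ)
    (hV : IsSubWeibull α η₂ V μ) : Integrable (fun ω => U ω * V ω) μ := by
  have := (hU.integrable_abs_mul_rpow hα h₁ h₂ one_pos hUm hVm hV).1
  simp only [Real.rpow_one] at this
  exact (integrable_norm_iff (hUm.mul hVm).aestronglyMeasurable).1 this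

theorem IsSubWeibull.integrable_mul_sq {Ω : Type*} [MeasurableSpace Ω] {μ : Measure Ω}
    [IsProbabilityMeasure μ] {α η₁ η₂ : ℝ} (hα : 0 < α) (h₁ : 0 < η₁) (h₂ : 0 < η₂)
    {U V : Ω → ℝ} (hUm : Measurable U) (hVm : Measurable V) (hU : IsSubWeibull α η₁ U μ)
    (hV : IsSubWeibull α η₂ V μ) : Integrable (fun ω => (U ω * V ω) ^ 2) μ := by
  have := (hU.integrable_abs_mul_rpow hα h₁ h₂ two_pos hUm hVm hV).1
  simpa only [Real.rpow_two, sq_abs] using this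

/-- The factor in the tail domination of a centred product of sub-Weibull variables. -/
noncomputable def productFactor (q : ℝ) : ℝ := 1 + 2 * Real.exp (q ^ 2)

theorem IsSubWeibull.isTailDominated_mul {Ω : Type*} [MeasurableSpace Ω] {μ : Measure Ω}
    [IsProbabilityMeasure μ] {α η₁ η₂ Γ : ℝ} (hα : 0 < α) (h₁ : 0 < η₁) (h₂ : 0 < η₂)
    {U V : Ω → ℝ} (hUm : Measurable U) (hVm : Measurable V) (hU : IsSubWeibull α η₁ U μ)
    (hV : IsSubWeibull α η₂ V μ) (hΓ : ∫ ω, (U ω * V ω) ^ 2 ∂μ ≤ Γ) :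
    IsTailDominated (2 / α) (productFactor (2 / α) * (η₁ * η₂)) Γ
      (fun ω => U ω * V ω - ∫ ω', U ω' * V ω' ∂μ) μ := by
  have hi := hU.integrable_mul hα h₁ h₂ hUm hVm hV
  have hi2 := hU.integrable_mul_sq hα h₁ h₂ hUm hVm hV
  have habs := (hU.integrable_abs_mul_rpow hα h₁ h₂ one_pos hUm hVm hV).2
  simp only [Real.rpow_one, mul_one] at habs
  set c := ∫ ω', U ω' * V ω' ∂μ with hc
  have hcle : |c| ≤ 2 * (η₁ * η₂) * Real.exp ((2 / α) ^ 2) :=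
    (abs_integral_le_integral_abs).trans habs
  have hL2 : MemLp (fun ω => U ω * V ω) 2 μ :=
    (memLp_two_iff_integrable_sq (hUm.mul hVm).aestronglyMeasurable).2 hi2
  refine ⟨(hUm.mul hVm).sub_const c, hi.sub (integrable_const c), ?_,
    (hL2.sub (memLp_const c)).integrable_sq, ?_, ?_⟩
  · rw [integral_sub hi (integrable_const c)]; simp [hc]
  · have h1 := variance_le_expectation_sq (μ := μ) (X := fun ω => U ω * V ω)
      (hUm.mul hVm).aestronglyMeasurable
    rw [variance_eq_integral (X := fun ω => U ω * V ω) (hUm.mul hVm).aemeasurable] at h1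
    exact h1.trans hΓ
  · obtain ⟨hWi, hWE⟩ := hU.exp_half_add hV
    -- The shift by 1 makes W ^ q ≥ 1, so that the constant mean is dominated too. It costs a factor
    -- e, and 2e ≤ 6 explains the bound 6.
    refine ⟨fun ω => 1 + ((|U ω| / η₁) ^ α + (|V ω| / η₂) ^ α) / 2, fun ω => by positivity, ?_, ?_,
      fun ω => ?_⟩
    · simp only [Real.exp_add 1]
      exact hWi.const_mul _
    · simp only [Real.exp_add 1]
      rw [integral_const_mul]
      nlinarith [Real.exp_one_lt_d9, Real.exp_pos 1]
    · set w := ((|U ω| / η₁) ^ α + (|V ω| / η₂) ^ α) / 2 with hw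
      have hw0 : 0 ≤ w := by positivity
      have hq : 0 < 2 / α := by positivity
      have h1 : |U ω * V ω| ≤ η₁ * η₂ * (1 + w) ^ (2 / α) :=
        (abs_mul_le_mul_rpow hα h₁ h₂ _ _).trans (by gcongr; linarith)
      have h2 : 1 ≤ (1 + w) ^ (2 / α) := Real.one_le_rpow (by linarith) hq.le
      have h3 : |c| ≤ 2 * (η₁ * η₂) * Real.exp ((2 / α) ^ 2) * (1 + w) ^ (2 / α) :=
        hcle.trans (le_mul_of_one_le_right (by positivity) h2)
      calc |U ω * V ω - c| ≤ |U ω * V ω| + |c| := abs_sub _ _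
        _ ≤ η₁ * η₂ * (1 + w) ^ (2 / α) +
            2 * (η₁ * η₂) * Real.exp ((2 / α) ^ 2) * (1 + w) ^ (2 / α) := add_le_add h1 h3
        _ = _ := by rw [productFactor]; ring

theorem IsTailDominated.mono {Ω : Type*} [MeasurableSpace Ω] {μ : Measure Ω} {q K K' Γ Γ' : ℝ}
    {Z : Ω → ℝ} (h : IsTailDominated q K Γ Z μ) (hK : K ≤ K') (hΓ : Γ ≤ Γ') :
    IsTailDominated q K' Γ' Z μ := by
  obtain ⟨h1, h2, h3, h4, h5, W, hW0, hWi, hWE, hZW⟩ := h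
  exact ⟨h1, h2, h3, h4, h5.trans hΓ, W, hW0, hWi, hWE, fun ω => (hZW ω).trans
    (mul_le_mul_of_nonneg_right hK (Real.rpow_nonneg (hW0 ω) _))⟩

theorem IsTailDominated.mul_sign {Ω : Type*} [MeasurableSpace Ω] {μ : Measure Ω} {q K Γ d : ℝ}
    {Z : Ω → ℝ} (h : IsTailDominated q K Γ Z μ) (hd : |d| = 1) :
    IsTailDominated q K Γ (fun ω => d * Z ω) μ := by
  obtain ⟨h1, h2, h3, h4, h5, W, hW0, hWi, hWE, hZW⟩ := h
  have hd2 : d ^ 2 = 1 := by rw [← sq_abs, hd, one_pow]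
  refine ⟨h1.const_mul d, h2.const_mul d, ?_, ?_, ?_, W, hW0, hWi, hWE, ?_⟩
  · rw [integral_const_mul, h3, mul_zero]
  · simpa [mul_pow, hd2] using h4
  · simpa [mul_pow, hd2] using h5
  · simpa [abs_mul, hd] using hZW

theorem IsTailDominated.comp {Ω Ω' : Type*} [MeasurableSpace Ω] [MeasurableSpace Ω']
    {μ : Measure Ω} {ν : Measure Ω'} {q K Γ : ℝ} {Z : Ω' → ℝ} {f : Ω → Ω'}
    (hf : MeasurePreserving f μ ν) (h : IsTailDominated q K Γ Z ν) :
    IsTailDominated q K Γ (fun ω => Z (f ω)) μ := by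
  have hint : ∀ g : Ω' → ℝ, Integrable g ν →
      Integrable (fun ω => g (f ω)) μ ∧ ∫ ω, g (f ω) ∂μ = ∫ x, g x ∂ν := by
    intro g hg
    refine ⟨hf.integrable_comp_of_integrable hg, ?_⟩
    have h1 : AEStronglyMeasurable g (μ.map f) := by
      rw [hf.map_eq]; exact hg.aestronglyMeasurable
    have := integral_map hf.measurable.aemeasurable h1
    rw [hf.map_eq] at this
    exact this.symm
  obtain ⟨h1, h2, h3, h4, h5, W, hW0, hWi, hWE, hZW⟩ := h
  refine ⟨h1.comp hf.measurable, (hint _ h2).1, (hint _ h2).2.trans h3, (hint _ h4).1,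
    (hint _ h4).2.trans_le h5, fun ω => W (f ω), fun ω => hW0 _, (hint _ hWi).1,
    (hint _ hWi).2.trans_le hWE, fun ω => hZW _⟩

theorem IsTailDominated.measureReal_abs_sum_gt_lt {Ω ι : Type*} [Fintype ι] [MeasurableSpace Ω]
    {μ : Measure Ω} [IsProbabilityMeasure μ] {Z : ι → Ω → ℝ} {q K Γ L V : ℝ} {n : ℕ}
    (h : ∀ i, IsTailDominated q K Γ (Z i) μ) (hind : iIndepFun Z μ) (hq : 1 ≤ q) (hK : 0 ≤ K)
    (hn : 1 ≤ n) (hcard : Fintype.card ι ≤ n) (hL : 1 ≤ L) (hV : 0 < V)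
    (hVar : Fintype.card ι * Γ * L ≤ V ^ 2)
    (hR : 8 * 5 ^ q * K * Real.log (2 * n) ^ q * L ^ q ≤ V) :
    μ.real {ω | 8 * V < |∑ i, Z i ω|} < 3 * Real.exp (-L) := by
  choose h1 h2 h3 h4 h5 W hW0 hWi hWE hZW using h
  exact _root_.measureReal_abs_sum_gt_lt hind h1 hq hK hW0 hWi hWE hZW h2 h3 h4 h5 hn hcard hL hV
    hVar hR

/-! ### Linear forms in the rows -/

namespace ResidualRandomization

theorem invSqrt_transpose {p : ℕ} (A : Matrix (Fin p) (Fin p) ℝ) : (invSqrt A)ᵀ = invSqrt A := by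
  have h : IsSelfAdjoint (invSqrt A) := cfc_predicate _ A
  simpa [IsSelfAdjoint, Matrix.star_eq_conjTranspose, conjTranspose_eq_transpose_of_trivial] using h

theorem spectrum_pos {p : ℕ} {A : Matrix (Fin p) (Fin p) ℝ} (hA : A.PosDef) {x : ℝ}
    (hx : x ∈ spectrum ℝ A) : 0 < x := by
  rw [hA.1.spectrum_real_eq_range_eigenvalues] at hx
  obtain ⟨i, rfl⟩ := hx
  exact hA.eigenvalues_pos i

theorem invSqrt_mul_invSqrt {p : ℕ} {A : Matrix (Fin p) (Fin p) ℝ} (hA : A.PosDef) :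
    invSqrt A * invSqrt A = A⁻¹ := by
  have hsa : IsSelfAdjoint A := hA.1
  have hfin : (spectrum ℝ A).Finite := Matrix.finite_real_spectrum
  -- The spectrum is finite, so continuity on it is automatic even for the function with a pole at
  -- 0.
  have hc : ∀ f : ℝ → ℝ, ContinuousOn f (spectrum ℝ A) := fun f => hfin.continuousOn f
  symm
  refine Matrix.inv_eq_right_inv ?_
  calc A * (invSqrt A * invSqrt A)
      = cfc (fun x : ℝ => x) A * (cfc (fun x : ℝ => (√x)⁻¹) A * cfc (fun x : ℝ => (√x)⁻¹) A) := by
        rw [cfc_id' ℝ A]; rfl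
    _ = cfc (fun x : ℝ => x * ((√x)⁻¹ * (√x)⁻¹)) A := by
        rw [← cfc_mul _ _ A (hc _) (hc _), ← cfc_mul _ _ A (hc _) (hc _)]
    _ = cfc (fun _ : ℝ => (1 : ℝ)) A := by
        refine cfc_congr fun x hx => ?_
        have h0 := spectrum_pos hA hx
        have h1 : √x * √x = x := Real.mul_self_sqrt h0.le
        have h2 : √x ≠ 0 := (Real.sqrt_pos.2 h0).ne'
        rw [← mul_inv, h1, mul_inv_cancel₀ h0.ne']
    _ = 1 := cfc_const_one ℝ A

theorem l2_sq {p : ℕ} (v : Fin p → ℝ) : l2 v ^ 2 = v ⬝ᵥ v := by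
  rw [l2, Real.sq_sqrt (Finset.sum_nonneg fun i _ => sq_nonneg _)]
  simp [dotProduct, sq]

theorem l2_smul {p : ℕ} {c : ℝ} (hc : 0 ≤ c) (v : Fin p → ℝ) : l2 (c • v) = c * l2 v := by
  rw [l2, l2, ← Real.sqrt_sq hc, ← Real.sqrt_mul (sq_nonneg c), Finset.mul_sum,
    Real.sqrt_sq hc]
  simp [mul_pow]

theorem dotProduct_mulVec_le_maxEigenvalue {p : ℕ} {A : Matrix (Fin p) (Fin p) ℝ} (hA : A.PosDef)
    (b : Fin p → ℝ) : b ⬝ᵥ (A *ᵥ b) ≤ maxEigenvalue A * (b ⬝ᵥ b) := by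
  open scoped MatrixOrder in
  have hle : A ≤ algebraMap ℝ _ (maxEigenvalue A) := by
    have : IsSelfAdjoint A := hA.1
    refine le_algebraMap_of_spectrum_le fun x hx => ?_
    exact le_csSup (Matrix.finite_real_spectrum (A := A)).bddAbove hx
  have h := (Matrix.le_iff.1 hle).dotProduct_mulVec_nonneg b
  rw [Matrix.sub_mulVec, dotProduct_sub, Algebra.algebraMap_eq_smul_one, smul_mulVec,
    one_mulVec, dotProduct_smul] at h
  simp at h
  linarith

theorem minEigenvalue_le_dotProduct_mulVec {p : ℕ} {A : Matrix (Fin p) (Fin p) ℝ} (hA : A.PosDef)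
    (b : Fin p → ℝ) : minEigenvalue A * (b ⬝ᵥ b) ≤ b ⬝ᵥ (A *ᵥ b) := by
  open scoped MatrixOrder in
  have hle : algebraMap ℝ _ (minEigenvalue A) ≤ A := by
    have : IsSelfAdjoint A := hA.1
    refine algebraMap_le_of_le_spectrum fun x hx => ?_
    exact csInf_le (Matrix.finite_real_spectrum (A := A)).bddBelow hx
  have h := (Matrix.le_iff.1 hle).dotProduct_mulVec_nonneg b
  rw [Matrix.sub_mulVec, dotProduct_sub, Algebra.algebraMap_eq_smul_one, smul_mulVec,
    one_mulVec, dotProduct_smul] at h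
  simp at h
  linarith

theorem minEigenvalue_pos {p : ℕ} (hp : 0 < p) {A : Matrix (Fin p) (Fin p) ℝ} (hA : A.PosDef) :
    0 < minEigenvalue A := by
  have : Nonempty (Fin p) := ⟨⟨0, hp⟩⟩
  have hne : (spectrum ℝ A).Nonempty := by
    rw [hA.1.spectrum_real_eq_range_eigenvalues]; exact Set.range_nonempty _
  exact spectrum_pos hA (hne.csInf_mem Matrix.finite_real_spectrum)

/-- Since bᵀx = (A^{1/2}b)ᵀ(A^{-1/2}x) and |A^{1/2}b|₂² = bᵀAb, the joint condition gives the linear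
form an Orlicz norm of at most κ √(bᵀAb). -/
theorem isSubWeibull_dotProduct {p : ℕ} {ν : Measure (Fin p → ℝ)} [IsProbabilityMeasure ν]
    {α : ℝ} {κ : ℝ≥0} (hα : 0 < α) {A : Matrix (Fin p) (Fin p) ℝ} (hA : A.PosDef)
    (hj : jointOrliczNorm α (fun x : Fin p → ℝ => invSqrt A *ᵥ x) ν ≤ κ) (b : Fin p → ℝ) {η : ℝ}
    (hη0 : 0 < η) (hη : κ * √(b ⬝ᵥ (A *ᵥ b)) < η) :
    IsSubWeibull α η (fun x => b ⬝ᵥ x) ν := by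
  set R := invSqrt A with hR
  have hRt : Rᵀ = R := invSqrt_transpose A
  have hRR : R * R = A⁻¹ := invSqrt_mul_invSqrt hA
  have hdet : IsUnit A.det := (Matrix.isUnit_iff_isUnit_det A).1 hA.isUnit
  -- This is A^{1/2} b, written with A^{-1/2} alone.
  set c := R *ᵥ (A *ᵥ b) with hc
  have hlin : ∀ x, c ⬝ᵥ (R *ᵥ x) = b ⬝ᵥ x := by
    intro x
    rw [hc, dotProduct_mulVec, ← mulVec_transpose, hRt, mulVec_mulVec, hRR, mulVec_mulVec,
      Matrix.nonsing_inv_mul _ hdet, one_mulVec]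
  have hnorm : l2 c ^ 2 = b ⬝ᵥ (A *ᵥ b) := by
    rw [l2_sq]
    conv_lhs => rw [hc]
    exact hlin _
  have hl2 : l2 c = √(b ⬝ᵥ (A *ᵥ b)) := by
    rw [← hnorm, Real.sqrt_sq (show 0 ≤ l2 c from Real.sqrt_nonneg _)]
  have hm : ∀ d : Fin p → ℝ, Measurable fun x : Fin p → ℝ => d ⬝ᵥ (R *ᵥ x) := by
    intro d
    have : Continuous fun x : Fin p → ℝ => d ⬝ᵥ (R *ᵥ x) := by fun_prop
    exact this.measurable
  rcases (Real.sqrt_nonneg (∑ i, c i ^ 2)).eq_or_lt with h0 | hpos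
  · have hc0 : c = 0 := by
      have : c ⬝ᵥ c = 0 := by rw [← l2_sq, l2, ← h0]; simp
      exact dotProduct_self_eq_zero.1 this
    have : ∀ x, b ⬝ᵥ x = 0 := fun x => by rw [← hlin, hc0, zero_dotProduct]
    simp only [IsSubWeibull, this, abs_zero, zero_div, Real.zero_rpow hα.ne', Real.exp_zero]
    refine ⟨integrable_const _, ?_⟩
    simp
  · change 0 < l2 c at hpos
    set θ := (l2 c)⁻¹ • c with hθ
    have hθ1 : l2 θ = 1 := by
      rw [hθ, l2_smul (inv_nonneg.2 hpos.le), inv_mul_cancel₀ hpos.ne']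
    have hle : orliczNorm α (fun x => θ ⬝ᵥ (R *ᵥ x)) ν ≤ κ :=
      (le_iSup₂ (f := fun (θ : Fin p → ℝ) (_ : l2 θ = 1) =>
        orliczNorm α (fun x => θ ⬝ᵥ (R *ᵥ x)) ν) θ hθ1).trans hj
    have hlt : κ < (η / l2 c).toNNReal := by
      rw [Real.lt_toNNReal_iff_coe_lt, lt_div_iff₀ hpos, hl2]
      exact hη
    have h := isSubWeibull_of_orliczNorm_lt hα (hm θ) (hle.trans_lt (by exact_mod_cast hlt))
    have heq : ∀ x, |θ ⬝ᵥ (R *ᵥ x)| / ((η / l2 c).toNNReal : ℝ) = |b ⬝ᵥ x| / η := by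
      intro x
      rw [Real.coe_toNNReal _ (by positivity), hθ, smul_dotProduct, hlin, smul_eq_mul, abs_mul,
        abs_of_pos (inv_pos.2 hpos)]
      field_simp
    simpa only [IsSubWeibull, heq] using h

end ResidualRandomization

/-! ### Products across two independent rows -/

/-- The second moment of U(x)V(y) is controlled by the fourth moments of U and V through AM-GM. This
is how Γ, which contains E x_u⁴, covers products of entries of different rows. -/
theorem IsSubWeibull.isTailDominated_prod_mul {Ω : Type*} [MeasurableSpace Ω] {ν : Measure Ω}
    [IsProbabilityMeasure ν] {α η₁ η₂ Γ : ℝ} (hα : 0 < α) (h₁ : 0 < η₁) (h₂ : 0 < η₂)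
    {U V : Ω → ℝ} (hUm : Measurable U) (hVm : Measurable V) (hU : IsSubWeibull α η₁ U ν)
    (hV : IsSubWeibull α η₂ V ν) (hU0 : ∫ x, U x ∂ν = 0) (hUΓ : ∫ x, (U x * U x) ^ 2 ∂ν ≤ Γ)
    (hVΓ : ∫ x, (V x * V x) ^ 2 ∂ν ≤ Γ) :
    IsTailDominated (2 / α) (productFactor (2 / α) * (η₁ * η₂)) Γ
      (fun z : Ω × Ω => U z.1 * V z.2) (ν.prod ν) := by
  have hU' : IsSubWeibull α η₁ (fun z : Ω × Ω => U z.1) (ν.prod ν) :=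
    hU.comp measurePreserving_fst
  have hV' : IsSubWeibull α η₂ (fun z : Ω × Ω => V z.2) (ν.prod ν) :=
    hV.comp measurePreserving_snd
  have hmU : Measurable fun z : Ω × Ω => U z.1 := hUm.comp measurable_fst
  have hmV : Measurable fun z : Ω × Ω => V z.2 := hVm.comp measurable_snd
  have hΓ : ∫ z : Ω × Ω, (U z.1 * V z.2) ^ 2 ∂(ν.prod ν) ≤ Γ := by
    have i1 : Integrable (fun z : Ω × Ω => (U z.1 * U z.1) ^ 2) (ν.prod ν) :=
      (hU.integrable_mul_sq hα h₁ h₁ hUm hUm hU).comp_fst ν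
    have i2 : Integrable (fun z : Ω × Ω => (V z.2 * V z.2) ^ 2) (ν.prod ν) :=
      (hV.integrable_mul_sq hα h₂ h₂ hVm hVm hV).comp_snd ν
    calc ∫ z : Ω × Ω, (U z.1 * V z.2) ^ 2 ∂(ν.prod ν)
        ≤ ∫ z : Ω × Ω, ((U z.1 * U z.1) ^ 2 + (V z.2 * V z.2) ^ 2) / 2 ∂(ν.prod ν) := by
          refine integral_mono (hU'.integrable_mul_sq hα h₁ h₂ hmU hmV hV')
            ((i1.add i2).div_const 2) fun z => ?_
          simp only [mul_pow]
          nlinarith [sq_nonneg (U z.1 ^ 2 - V z.2 ^ 2)]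
      _ = (∫ x, (U x * U x) ^ 2 ∂ν + ∫ x, (V x * V x) ^ 2 ∂ν) / 2 := by
          rw [integral_div, integral_add i1 i2,
            integral_fun_fst (fun x => (U x * U x) ^ 2),
            integral_fun_snd (fun x => (V x * V x) ^ 2)]
          simp
      _ ≤ Γ := by linarith
  have := hU'.isTailDominated_mul hα h₁ h₂ hmU hmV hV' hΓ
  have hmean : ∫ z : Ω × Ω, U z.1 * V z.2 ∂(ν.prod ν) = 0 := by
    rw [integral_prod_mul U V, hU0, zero_mul]
  simpa only [hmean, sub_zero] using this

/-! ### Consequences of the covariate condition -/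

namespace ResidualRandomization

theorem CovariateCondition.covMatrix_apply {p : ℕ} {ν : Measure (Fin p → ℝ)} {α : ℝ} {κ : ℝ≥0}
    (h : CovariateCondition ν α κ) (u v : Fin p) : covMatrix ν u v = ∫ x, x u * x v ∂ν := by
  simp [covMatrix, covariance, h.mean_zero]

theorem CovariateCondition.covMatrix_pos {p : ℕ} {ν : Measure (Fin p → ℝ)} {α : ℝ} {κ : ℝ≥0}
    (h : CovariateCondition ν α κ) (v : Fin p) : 0 < covMatrix ν v v := h.posDef.diag_pos

/-- If κ were 0, the second moment of an entry would be at most Cη² for every η > 0, contradicting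
the positive diagonal of Σ. -/
theorem CovariateCondition.kappa_pos {p : ℕ} (hp : 0 < p) {ν : Measure (Fin p → ℝ)}
    [IsProbabilityMeasure ν] {α : ℝ} {κ : ℝ≥0} (hα : 0 < α) (h : CovariateCondition ν α κ) :
    0 < κ := by
  by_contra! hκ
  have hκ0 : κ = 0 := le_antisymm hκ bot_le
  set v : Fin p := ⟨0, hp⟩
  have hm : Measurable fun x : Fin p → ℝ => x v := measurable_pi_apply v
  set C := 2 * Real.exp ((2 / α * 1) ^ 2) with hC
  have hCpos : 0 < C := by positivity
  have hbd : ∀ η : ℝ≥0, 0 < η → covMatrix ν v v ≤ C * (η : ℝ) ^ 2 := by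
    intro η hη
    have hη' : (0 : ℝ) < η := by exact_mod_cast hη
    have hs : IsSubWeibull α η (fun x : Fin p → ℝ => x v) ν :=
      isSubWeibull_of_orliczNorm_lt hα hm ((h.entry_le v).trans_lt (by rw [hκ0]; exact_mod_cast hη))
    have h1 := (hs.integrable_abs_mul_rpow hα hη' hη' one_pos hm hm hs).2
    simp only [Real.rpow_one, abs_mul_self] at h1
    rw [h.covMatrix_apply]
    refine h1.trans (le_of_eq ?_)
    rw [hC]; ring
  set t := covMatrix ν v v with ht
  have htpos : 0 < t := h.covMatrix_pos v
  have h2 := hbd (Real.toNNReal √(t / (2 * C))) (by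
    rw [Real.toNNReal_pos]; positivity)
  rw [Real.coe_toNNReal _ (Real.sqrt_nonneg _), Real.sq_sqrt (by positivity)] at h2
  have : C * (t / (2 * C)) = t / 2 := by field_simp
  linarith

theorem CovariateCondition.isSubWeibull_entry {p : ℕ} {ν : Measure (Fin p → ℝ)}
    [IsProbabilityMeasure ν] {α : ℝ} {κ : ℝ≥0} (hα : 0 < α) (hκ : 0 < κ)
    (h : CovariateCondition ν α κ) (v : Fin p) :
    IsSubWeibull α (2 * κ) (fun x : Fin p → ℝ => x v) ν := by
  have hlt : κ < 2 * κ := by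
    rw [two_mul]; exact lt_add_of_pos_right _ hκ
  have := isSubWeibull_of_orliczNorm_lt (η := 2 * κ) hα (measurable_pi_apply v)
    ((h.entry_le v).trans_lt (by exact_mod_cast hlt))
  simpa using this

theorem integral_mul_sq_le_Gam {p : ℕ} (ν : Measure (Fin p → ℝ)) (a : Fin p → ℝ) (u v : Fin p) :
    ∫ x, (x u * x v) ^ 2 ∂ν ≤ Gam ν a :=
  (le_ciSup (f := fun uv : Fin p × Fin p => ∫ x, (x uv.1 * x uv.2) ^ 2 ∂ν)
    (Set.finite_range _).bddAbove (u, v)).trans (le_max_right _ _)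

theorem integral_dotProduct_mul_sq_le_Gam {p : ℕ} (ν : Measure (Fin p → ℝ)) (a : Fin p → ℝ)
    (v : Fin p) :
    ∫ x, ((a ᵥ* (covMatrix ν)⁻¹) ⬝ᵥ x * x v) ^ 2 ∂ν ≤ Gam ν a :=
  (le_ciSup (f := fun v : Fin p => ∫ x, ((a ᵥ* (covMatrix ν)⁻¹) ⬝ᵥ x * x v) ^ 2 ∂ν)
    (Set.finite_range _).bddAbove v).trans ((le_max_left _ _).trans (le_max_left _ _))

/-- Jensen: E x_v⁴ ≥ (E x_v²)² > 0. -/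
theorem CovariateCondition.Gam_pos {p : ℕ} (hp : 0 < p) {ν : Measure (Fin p → ℝ)}
    [IsProbabilityMeasure ν] {α : ℝ} {κ : ℝ≥0} (hα : 0 < α) (h : CovariateCondition ν α κ)
    (a : Fin p → ℝ) : 0 < Gam ν a := by
  have hκ := h.kappa_pos hp hα
  set v : Fin p := ⟨0, hp⟩
  have hm : Measurable fun x : Fin p → ℝ => x v := measurable_pi_apply v
  have hκ' : (0 : ℝ) < 2 * κ := by have : (0 : ℝ) < κ := by exact_mod_cast hκ
                                   linarith
  have hs := h.isSubWeibull_entry hα hκ v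
  have hi2 := hs.integrable_mul_sq hα hκ' hκ' hm hm hs
  refine lt_of_lt_of_le ?_ (integral_mul_sq_le_Gam ν a v v)
  have hL2 : MemLp (fun x : Fin p → ℝ => x v * x v) 2 ν :=
    (memLp_two_iff_integrable_sq (hm.mul hm).aestronglyMeasurable).2 hi2
  have h1 := variance_nonneg (fun x : Fin p → ℝ => x v * x v) ν
  rw [variance_eq_sub hL2] at h1
  have h2 := h.covMatrix_pos v
  rw [h.covMatrix_apply] at h2
  have h3 : ∫ x, ((fun x : Fin p → ℝ => x v * x v) ^ 2) x ∂ν = ∫ x, (x v * x v) ^ 2 ∂ν := rfl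
  rw [h3] at h1
  nlinarith [sq_nonneg (∫ x, x v * x v ∂ν), mul_pos h2 h2]

theorem sq_le_kappaStar {p : ℕ} {ν : Measure (Fin p → ℝ)} {a : Fin p → ℝ}
    {κ : ℝ≥0} : (κ : ℝ) ^ 2 ≤ kappaStar ν a κ :=
  le_mul_of_one_le_right (sq_nonneg _) (le_max_right _ _)

theorem productFactor_pos (q : ℝ) : 0 < productFactor q := by
  unfold productFactor; positivity

theorem CovariateCondition.isTailDominated_entries {p : ℕ} (hp : 0 < p) {ν : Measure (Fin p → ℝ)}
    [IsProbabilityMeasure ν] {α : ℝ} {κ : ℝ≥0} (hα : 0 < α) (h : CovariateCondition ν α κ)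
    (a : Fin p → ℝ) (u v : Fin p) :
    IsTailDominated (2 / α) (productFactor (2 / α) * (4 * kappaStar ν a κ)) (Gam ν a)
      (fun x => x u * x v - covMatrix ν u v) ν := by
  have hκ := h.kappa_pos hp hα
  have hκ' : (0 : ℝ) < 2 * κ := by have : (0 : ℝ) < κ := by exact_mod_cast hκ
                                   linarith
  have := (h.isSubWeibull_entry hα hκ u).isTailDominated_mul hα hκ' hκ' (measurable_pi_apply u)
    (measurable_pi_apply v) (h.isSubWeibull_entry hα hκ v) (integral_mul_sq_le_Gam ν a u v)
  rw [h.covMatrix_apply]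
  refine this.mono (mul_le_mul_of_nonneg_left ?_ (productFactor_pos _).le) le_rfl
  have := sq_le_kappaStar (ν := ν) (a := a) (κ := κ)
  nlinarith

theorem CovariateCondition.isTailDominated_prod {p : ℕ} (hp : 0 < p) {ν : Measure (Fin p → ℝ)}
    [IsProbabilityMeasure ν] {α : ℝ} {κ : ℝ≥0} (hα : 0 < α) (h : CovariateCondition ν α κ)
    (a : Fin p → ℝ) (u v : Fin p) :
    IsTailDominated (2 / α) (productFactor (2 / α) * (4 * kappaStar ν a κ)) (Gam ν a)
      (fun z => z.1 u * z.2 v) (ν.prod ν) := by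
  have hκ := h.kappa_pos hp hα
  have hκ' : (0 : ℝ) < 2 * κ := by have : (0 : ℝ) < κ := by exact_mod_cast hκ
                                   linarith
  have hm : ∀ w, Measurable fun x : Fin p → ℝ => x w := fun w => measurable_pi_apply w
  have hmean : ∀ w, ∫ x : Fin p → ℝ, x w ∂ν = 0 := h.mean_zero
  have := (h.isSubWeibull_entry hα hκ u).isTailDominated_prod_mul hα hκ' hκ' (hm u) (hm v)
    (h.isSubWeibull_entry hα hκ v) (hmean u) (integral_mul_sq_le_Gam ν a u u)
    (integral_mul_sq_le_Gam ν a v v)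
  refine this.mono (mul_le_mul_of_nonneg_left ?_ (productFactor_pos _).le) le_rfl
  have := sq_le_kappaStar (ν := ν) (a := a) (κ := κ)
  nlinarith

theorem CovariateCondition.isTailDominated_dotProduct {p : ℕ} (hp : 0 < p)
    {ν : Measure (Fin p → ℝ)}
    [IsProbabilityMeasure ν] {α : ℝ} {κ : ℝ≥0} (hα : 0 < α) (h : CovariateCondition ν α κ)
    (a : Fin p → ℝ) (v : Fin p) :
    IsTailDominated (2 / α) (productFactor (2 / α) * (4 * kappaStar ν a κ)) (Gam ν a)
      (fun x => (a ᵥ* (covMatrix ν)⁻¹) ⬝ᵥ x * x v - a v) ν := by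
  have hκ : (0 : ℝ) < κ := by exact_mod_cast h.kappa_pos hp hα
  have hA := h.posDef
  set A := covMatrix ν with hAdef
  have hAt : Aᵀ = A := by
    simpa [Matrix.IsHermitian, conjTranspose_eq_transpose_of_trivial] using hA.1
  have hdet : IsUnit A.det := (Matrix.isUnit_iff_isUnit_det A).1 hA.isUnit
  set b := a ᵥ* A⁻¹ with hb
  have hbA : A *ᵥ b = a := by
    rw [← hAt, mulVec_transpose, hb, vecMul_vecMul, Matrix.nonsing_inv_mul _ hdet, vecMul_one]
  set lmin := minEigenvalue A
  set lmax := maxEigenvalue A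
  have hmin : 0 < lmin := minEigenvalue_pos hp hA
  have hdiag : ∀ w, A w w ≤ lmax := by
    intro w
    have := dotProduct_mulVec_le_maxEigenvalue hA (Pi.single w 1)
    simpa using this
  have hmax : 0 < lmax := (h.covMatrix_pos v).trans_le (hdiag v)
  -- Here bᵀΣb = aᵀΣ⁻¹a = |Ra|₂² with R = Σ^{-1/2}; the Rayleigh bound at Ra gives λ_min |Ra|₂² ≤
  -- |a|₂².
  have hqb : √(b ⬝ᵥ (A *ᵥ b)) ≤ l2 a / √lmin := by
    set R := invSqrt A
    have hRt : Rᵀ = R := invSqrt_transpose A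
    have hRR : R * R = A⁻¹ := invSqrt_mul_invSqrt hA
    have h1 := minEigenvalue_le_dotProduct_mulVec hA (R *ᵥ a)
    have hsw : ∀ x y : Fin p → ℝ, (R *ᵥ x) ⬝ᵥ y = x ⬝ᵥ (R *ᵥ y) := fun x y => by
      rw [dotProduct_mulVec, ← mulVec_transpose, hRt]
    have h2 : (R *ᵥ a) ⬝ᵥ (R *ᵥ a) = b ⬝ᵥ (A *ᵥ b) := by
      rw [hsw, mulVec_mulVec, hRR, hbA, dotProduct_mulVec]
    have hRAR : R * A * R = 1 := by
      refine mul_eq_one_comm.1 ?_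
      rw [← mul_assoc, hRR, Matrix.nonsing_inv_mul _ hdet]
    have h4 : (R *ᵥ a) ⬝ᵥ (A *ᵥ (R *ᵥ a)) = l2 a ^ 2 := by
      rw [hsw, mulVec_mulVec, mulVec_mulVec, hRAR, one_mulVec, l2_sq]
    rw [h2, h4] at h1
    rw [le_div_iff₀ (Real.sqrt_pos.2 hmin), ← Real.sqrt_mul' _ hmin.le]
    refine Real.sqrt_le_iff.2 ⟨Real.sqrt_nonneg _, ?_⟩
    linarith
  have hκs : 0 < kappaStar ν a κ :=
    lt_of_lt_of_le (by positivity) sq_le_kappaStar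
  set η₂ := 2 * κ * √lmax with hη₂
  -- Chosen so that η₁ η₂ = 4κ⋆ exactly; the maximum with 1 in κ⋆ keeps η₁ positive even for a = 0.
  set η₁ := 2 * kappaStar ν a κ / (κ * √lmax) with hη₁
  have hsl : 0 < √lmax := Real.sqrt_pos.2 hmax
  have hη₂0 : 0 < η₂ := by positivity
  have hη₁0 : 0 < η₁ := by positivity
  have hU : IsSubWeibull α η₁ (fun x => b ⬝ᵥ x) ν := by
    refine isSubWeibull_dotProduct hα hA h.joint_le b hη₁0 ?_
    have h1 : κ * √(b ⬝ᵥ (A *ᵥ b)) ≤ η₁ / 2 := by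
      calc κ * √(b ⬝ᵥ (A *ᵥ b)) ≤ κ * (l2 a / √lmin) := by gcongr
        _ = κ ^ 2 * (l2 a * √lmax / √lmin) / (κ * √lmax) := by field_simp
        _ ≤ kappaStar ν a κ / (κ * √lmax) := by
            unfold kappaStar
            gcongr
            exact le_max_left _ _
        _ = η₁ / 2 := by rw [hη₁]; ring
    linarith
  have hV : IsSubWeibull α η₂ (fun x => x v) ν := by
    have := isSubWeibull_dotProduct hα hA h.joint_le (Pi.single v 1) hη₂0 (by
      have h1 : √(Pi.single v 1 ⬝ᵥ (A *ᵥ Pi.single v 1)) ≤ √lmax :=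
        Real.sqrt_le_sqrt (by simpa using hdiag v)
      nlinarith [mul_le_mul_of_nonneg_left h1 hκ.le, mul_pos hκ hsl])
    simpa using this
  have hprod : η₁ * η₂ = 4 * kappaStar ν a κ := by
    rw [hη₁, hη₂]; field_simp; ring
  have hmb : Measurable fun x : Fin p → ℝ => b ⬝ᵥ x := by
    have : Continuous fun x : Fin p → ℝ => b ⬝ᵥ x := by fun_prop
    exact this.measurable
  have := hU.isTailDominated_mul hα hη₁0 hη₂0 hmb (measurable_pi_apply v) hV
    (integral_dotProduct_mul_sq_le_Gam ν a v)
  have hmean : ∫ x, b ⬝ᵥ x * x v ∂ν = a v := by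
    have hκn := h.kappa_pos hp hα
    have hκ' : (0 : ℝ) < 2 * κ := by positivity
    have hi : ∀ u, Integrable (fun x : Fin p → ℝ => b u * (x u * x v)) ν := fun u =>
      ((h.isSubWeibull_entry hα hκn u).integrable_mul hα hκ' hκ' (measurable_pi_apply u)
        (measurable_pi_apply v) (h.isSubWeibull_entry hα hκn v)).const_mul _
    calc ∫ x, b ⬝ᵥ x * x v ∂ν = ∫ x, ∑ u, b u * (x u * x v) ∂ν := by
          simp only [dotProduct, Finset.sum_mul, mul_assoc]
      _ = ∑ u, b u * A u v := by
          rw [integral_finsetSum _ fun u _ => hi u]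
          simp only [integral_const_mul, hAdef, h.covMatrix_apply]
      _ = (A *ᵥ b) v := by
          rw [← hAt, mulVec_transpose, hAt]; rfl
      _ = a v := by rw [hbA]
  rw [hprod, hmean] at this
  exact this

end ResidualRandomization

/-! ### Independence of disjoint pairs of rows -/

/-- Injectivity of `Sum.elim f g` says that all the selected indices are distinct. The selected
coordinates are then i.i.d., and regrouping them gives independent pairs. -/
theorem measurePreserving_pairs {ι J E : Type*} [Fintype ι] [Fintype J] [MeasurableSpace E]
    (ν : Measure E) [IsProbabilityMeasure ν] {f g : J → ι}
    (hfg : Function.Injective (Sum.elim f g)) :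
    MeasurePreserving (fun (x : ι → E) (j : J) => (x (f j), x (g j))) (Measure.pi fun _ => ν)
      (Measure.pi fun _ => ν.prod ν) := by
  have hev : ∀ i : ι, (Measure.pi fun _ : ι => ν).map (fun x => x i) = ν := fun i =>
    (measurePreserving_eval (fun _ : ι => ν) i).map_eq
  have hind : iIndepFun (fun (i : ι) (x : ι → E) => x i) (Measure.pi fun _ => ν) :=
    iIndepFun_pi (X := fun _ y => y) fun _ => aemeasurable_id
  have h1 : MeasurePreserving (fun (x : ι → E) (s : J ⊕ J) => x (Sum.elim f g s))
      (Measure.pi fun _ => ν) (Measure.pi fun _ => ν) := by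
    refine ⟨measurable_pi_lambda _ fun s => measurable_pi_apply _, ?_⟩
    have := (hind.precomp hfg).map_fun_eq_pi_map fun s => (measurable_pi_apply _).aemeasurable
    rw [this]
    congr 1
    funext s
    exact hev _
  have h2 := measurePreserving_sumPiEquivProdPi (X := fun _ : J ⊕ J => E) (fun _ : J ⊕ J => ν)
  have h3 := (measurePreserving_arrowProdEquivProdArrow E E J (fun _ => ν) (fun _ => ν)).symm
  exact h3.comp (h2.comp h1)

theorem iIndepFun_pairs {ι J E : Type*} [Fintype ι] [Fintype J] [MeasurableSpace E]
    (ν : Measure E) [IsProbabilityMeasure ν] {f g : J → ι}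
    (hfg : Function.Injective (Sum.elim f g)) :
    iIndepFun (fun (j : J) (x : ι → E) => (x (f j), x (g j))) (Measure.pi fun _ => ν) ∧
      ∀ j, MeasurePreserving (fun x : ι → E => (x (f j), x (g j))) (Measure.pi fun _ => ν)
        (ν.prod ν) := by
  have h := measurePreserving_pairs ν hfg
  have hmp : ∀ j, MeasurePreserving (fun x : ι → E => (x (f j), x (g j)))
      (Measure.pi fun _ => ν) (ν.prod ν) := fun j =>
    (measurePreserving_eval (fun _ : J => ν.prod ν) j).comp h
  refine ⟨(iIndepFun_iff_map_fun_eq_pi_map fun j => (hmp j).measurable.aemeasurable).2 ?_, hmp⟩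
  rw [h.map_eq]
  congr 1
  funext j
  exact (hmp j).map_eq.symm

/-! ### Tail bounds for sums over rows and for the entries of XᵀGX -/

namespace ResidualRandomization

/-- The numerical conditions under which the tail bounds hold. -/
structure TailCondition (n : ℕ) (q K Γ L V : ℝ) : Prop where
  one_le_q : 1 ≤ q
  K_nonneg : 0 ≤ K
  one_le_n : 1 ≤ n
  one_le_L : 1 ≤ L
  V_pos : 0 < V
  variance_eq : n * Γ * L = 2 * V ^ 2
  tail_le : 8 * 5 ^ q * K * Real.log (2 * n) ^ q * L ^ q ≤ V

section

variable {n p : ℕ} {ν : Measure (Fin p → ℝ)} [IsProbabilityMeasure ν] {q K Γ L V : ℝ}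

theorem TailCondition.measureReal_sum_rows_lt (hc : TailCondition n q K Γ L V)
    {Z : Fin n → (Fin p → ℝ) → ℝ} (hZ : ∀ i, IsTailDominated q K Γ (Z i) ν) :
    (Measure.pi fun _ : Fin n => ν).real {x | 8 * (√2 * V) < |∑ i, Z i (x i)|} <
      3 * Real.exp (-L) := by
  have hV := hc.V_pos
  have hs2 : √2 ^ 2 = (2 : ℝ) := Real.sq_sqrt (by norm_num)
  have h1 : (1 : ℝ) ≤ √2 := Real.one_le_sqrt.2 (by norm_num)
  refine IsTailDominated.measureReal_abs_sum_gt_lt (n := n)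
    (fun i => (hZ i).comp (measurePreserving_eval (fun _ : Fin n => ν) i))
    (iIndepFun_pi (X := Z) fun i => (hZ i).1.aemeasurable)
    hc.one_le_q hc.K_nonneg hc.one_le_n (by simp) hc.one_le_L (by positivity) ?_ ?_
  · rw [Fintype.card_fin, hc.variance_eq, mul_pow, hs2]
  · exact hc.tail_le.trans (le_mul_of_one_le_left hV.le h1)

/-- Only n/2 summands occur, so the variance condition holds with V itself, without the factor √2
needed for all n rows. -/
theorem TailCondition.measureReal_sum_pairs_lt (hc : TailCondition n q K Γ L V)
    {Z : (Fin p → ℝ) × (Fin p → ℝ) → ℝ} (hZ : IsTailDominated q K Γ Z (ν.prod ν))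
    {N : Finset (Fin n)} (hN : 2 * N.card = n) (g : Equiv.Perm (Fin n))
    (hg : ∀ j ∈ N, g j ∉ N) :
    (Measure.pi fun _ : Fin n => ν).real {x | 8 * V < |∑ i ∈ N, Z (x i, x (g i))|} <
      3 * Real.exp (-L) := by
  have hinj : Function.Injective (Sum.elim (fun j : N => (j : Fin n)) fun j : N => g j) := by
    refine Function.Injective.sumElim Subtype.val_injective
      (g.injective.comp Subtype.val_injective) fun a b hab => ?_
    exact hg b b.2 (hab ▸ a.2)
  obtain ⟨hind, hmp⟩ := iIndepFun_pairs ν hinj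
  have := IsTailDominated.measureReal_abs_sum_gt_lt (ι := N) (n := n) (V := V) (L := L)
    (fun j => hZ.comp (hmp j)) (hind.comp (fun _ => Z) fun _ => hZ.1)
    hc.one_le_q hc.K_nonneg hc.one_le_n (by simp; omega) hc.one_le_L hc.V_pos (by
      have h2 : (2 : ℝ) * N.card = n := by exact_mod_cast hN
      have := hc.variance_eq
      rw [← h2] at this
      rw [Fintype.card_coe]
      linarith) hc.tail_le
  refine lt_of_eq_of_lt ?_ this
  congr 1
  ext x
  simp only [Set.mem_ofPred_eq]
  rw [Finset.sum_coe_sort N fun i => Z (x i, x (g i))]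

/-- The entries of `Xᵀ G X` for a permutation matrix `G`. -/
theorem transpose_mul_permMatrix_mul_apply (X : Matrix (Fin n) (Fin p) ℝ) (g : Equiv.Perm (Fin n))
    (u v : Fin p) : (Xᵀ * g.permMatrix ℝ * X) u v = ∑ i, X i u * X (g i) v := by
  rw [Matrix.mul_assoc, Equiv.Perm.permMatrix, PEquiv.toMatrix_toPEquiv_mul, Matrix.mul_apply]
  rfl

theorem transpose_mul_diagonal_mul_apply (X : Matrix (Fin n) (Fin p) ℝ) (d : Fin n → ℝ)
    (u v : Fin p) : (Xᵀ * diagonal d * X) u v = ∑ i, d i * (X i u * X i v) := by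
  rw [Matrix.mul_apply]
  simp only [mul_diagonal, transpose_apply]
  exact Finset.sum_congr rfl fun i _ => by ring

theorem TailCondition.measureReal_perm_lt (hc : TailCondition n q K Γ L V)
    (hZ : ∀ u v, IsTailDominated q K Γ (fun z : (Fin p → ℝ) × (Fin p → ℝ) => z.1 u * z.2 v)
      (ν.prod ν))
    {G : Matrix (Fin n) (Fin n) ℝ} (hG : G ∈ permSet n) (u v : Fin p) :
    (Measure.pi fun _ : Fin n => ν).real
      {x | 16 * V < |((of x)ᵀ * G * of x) u v|} < 6 * Real.exp (-L) := by
  obtain ⟨g, rfl, N₁, N₂, hdis, hun, hcard, h12, h21⟩ := hG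
  have hn : N₁.card + N₂.card = n := by
    rw [← Finset.card_union_of_disjoint hdis, hun, Finset.card_univ, Fintype.card_fin]
  have b1 := hc.measureReal_sum_pairs_lt (hZ u v) (N := N₁) (by omega) g
    fun j hj hj' => Finset.disjoint_left.1 hdis hj' (h12 j hj)
  have b2 := hc.measureReal_sum_pairs_lt (hZ u v) (N := N₂) (by omega) g
    fun j hj hj' => Finset.disjoint_left.1 hdis (h21 j hj) hj'
  have hsub : {x : Fin n → Fin p → ℝ | 16 * V < |((of x)ᵀ * g.permMatrix ℝ * of x) u v|} ⊆
      {x | 8 * V < |∑ i ∈ N₁, x i u * x (g i) v|} ∪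
      {x | 8 * V < |∑ i ∈ N₂, x i u * x (g i) v|} := by
    intro x hx
    simp only [Set.mem_ofPred_eq, Set.mem_union, transpose_mul_permMatrix_mul_apply, of_apply]
      at hx ⊢
    rw [← hun, Finset.sum_union hdis] at hx
    by_contra! hcon
    linarith [abs_add_le (∑ i ∈ N₁, x i u * x (g i) v) (∑ i ∈ N₂, x i u * x (g i) v)]
  refine (measureReal_mono hsub).trans_lt ((measureReal_union_le _ _).trans_lt ?_)
  linarith

theorem sum_eq_zero_of_balanced {d : Fin n → ℝ} (hd : ∀ i, d i = 1 ∨ d i = -1)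
    (hbal : {i | d i = 1}.ncard = {i | d i = -1}.ncard) : ∑ i, d i = 0 := by
  classical
  have h : ∀ i, d i = (if d i = 1 then 1 else 0) - (if d i = -1 then (1 : ℝ) else 0) := by
    intro i
    rcases hd i with h | h <;> rw [h] <;> norm_num
  rw [Finset.sum_congr rfl fun i _ => h i, Finset.sum_sub_distrib, Finset.sum_boole,
    Finset.sum_boole, sub_eq_zero]
  have hn : ∀ c : ℝ, {i | d i = c}.ncard = (Finset.univ.filter fun i => d i = c).card := fun c => by
    rw [← Set.ncard_coe_finset]; simp
  rw [hn, hn] at hbal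
  exact_mod_cast hbal

theorem TailCondition.measureReal_sign_lt (hc : TailCondition n q K Γ L V)
    {A : Matrix (Fin p) (Fin p) ℝ}
    (hZ : ∀ u v, IsTailDominated q K Γ (fun x : Fin p → ℝ => x u * x v - A u v) ν)
    {G : Matrix (Fin n) (Fin n) ℝ} (hG : G ∈ signSet n) (u v : Fin p) :
    (Measure.pi fun _ : Fin n => ν).real
      {x | 16 * V < |((of x)ᵀ * G * of x) u v|} < 6 * Real.exp (-L) := by
  obtain ⟨d, rfl, hd, hbal⟩ := hG
  have h0 := sum_eq_zero_of_balanced hd hbal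
  have habs : ∀ i, |d i| = 1 := fun i => by rcases hd i with h | h <;> simp [h]
  have b := hc.measureReal_sum_rows_lt fun i => (hZ u v).mul_sign (habs i)
  have hV := hc.V_pos
  have hs2 : √2 ≤ (2 : ℝ) := by rw [Real.sqrt_le_left (by norm_num)]; norm_num
  have hsub : {x : Fin n → Fin p → ℝ | 16 * V < |((of x)ᵀ * diagonal d * of x) u v|} ⊆
      {x | 8 * (√2 * V) < |∑ i, d i * (x i u * x i v - A u v)|} := by
    intro x hx
    simp only [Set.mem_ofPred_eq, transpose_mul_diagonal_mul_apply, of_apply] at hx ⊢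
    -- Balanced signs sum to 0, so centring each product leaves the signed sum unchanged.
    have : ∑ i, d i * (x i u * x i v - A u v) = ∑ i, d i * (x i u * x i v) := by
      simp only [mul_sub, Finset.sum_sub_distrib, ← Finset.sum_mul, h0, zero_mul, sub_zero]
    rw [this]
    nlinarith
  have := Real.exp_pos (-L)
  linarith [measureReal_mono (μ := Measure.pi fun _ : Fin n => ν) hsub]

/-- The unions over the clusters of the first halves and of the second halves are two halves of [n]
that g exchanges. -/
theorem clusterSet_subset_permSet {nc : ℕ} {L : Fin nc → Finset (Fin n)} (hL : IsClustering L) :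
    clusterSet L ⊆ permSet n := by
  classical
  rintro G ⟨g, rfl, hg⟩
  obtain ⟨hdis, hcov, -⟩ := hL
  choose N₁ N₂ hd hu hcard h12 h21 using hg
  have hsub1 : ∀ k, N₁ k ⊆ L k := fun k => hu k ▸ Finset.subset_union_left
  have hsub2 : ∀ k, N₂ k ⊆ L k := fun k => hu k ▸ Finset.subset_union_right
  refine ⟨g, rfl, Finset.univ.biUnion N₁, Finset.univ.biUnion N₂, ?_, ?_, ?_, ?_, ?_⟩
  · rw [Finset.disjoint_biUnion_left]
    intro k _
    rw [Finset.disjoint_biUnion_right]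
    intro l _
    by_cases hkl : k = l
    · subst hkl; exact hd k
    · exact (hdis k l hkl).mono (hsub1 k) (hsub2 l)
  · ext i
    obtain ⟨k, hk⟩ := hcov i
    rw [← hu k, Finset.mem_union] at hk
    simp only [Finset.mem_union, Finset.mem_biUnion, Finset.mem_univ, true_and, iff_true]
    exact hk.imp (fun h => ⟨k, h⟩) fun h => ⟨k, h⟩
  · rw [Finset.card_biUnion fun k _ l _ hkl => (hdis k l hkl).mono (hsub1 k) (hsub1 l),
      Finset.card_biUnion fun k _ l _ hkl => (hdis k l hkl).mono (hsub2 k) (hsub2 l)]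
    exact Finset.sum_congr rfl fun k _ => hcard k
  · intro j hj
    obtain ⟨k, -, hk⟩ := Finset.mem_biUnion.1 hj
    exact Finset.mem_biUnion.2 ⟨k, Finset.mem_univ _, h12 k j hk⟩
  · intro j hj
    obtain ⟨k, -, hk⟩ := Finset.mem_biUnion.1 hj
    exact Finset.mem_biUnion.2 ⟨k, Finset.mem_univ _, h21 k j hk⟩

theorem GroupCondition.mem_permSet_or_mem_signSet {𝒢 : Finset (Matrix (Fin n) (Fin n) ℝ)}
    (h : GroupCondition 𝒢) {G : Matrix (Fin n) (Fin n) ℝ} (hG : G ∈ 𝒢) :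
    G ∈ permSet n ∨ G ∈ signSet n := by
  rcases h with h | h | ⟨nc, L, hL, h⟩
  · exact Or.inl (h hG)
  · exact Or.inr (h hG)
  · exact Or.inl (clusterSet_subset_permSet hL (h hG))

end

end ResidualRandomization

/-! ### The transport cost and the selection of the matrix -/

theorem toMeasure_map_uniformOfFinset {α β : Type*} [MeasurableSpace β] (s : Finset α)
    (hs : s.Nonempty) (f : α → β) :
    ((PMF.uniformOfFinset s hs).map f).toMeasure =
      ∑ a ∈ s, (s.card : ℝ≥0∞)⁻¹ • Measure.dirac (f a) := by
  classical
  let _ : MeasurableSpace α := ⊤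
  ext S hS
  rw [PMF.toMeasure_map_apply f _ S measurable_from_top hS,
    PMF.toMeasure_uniformOfFinset_apply hs _ MeasurableSpace.measurableSet_top,
    Measure.finsetSum_apply]
  simp only [Measure.smul_apply, Measure.dirac_apply' _ hS, smul_eq_mul, ← Finset.mul_sum]
  rw [div_eq_mul_inv, mul_comm]
  congr 1
  simp [Set.indicator_apply, Finset.sum_boole]

namespace ResidualRandomization

theorem wasserstein1_randomizationDist_le {n : ℕ} (𝒢 : Finset (Matrix (Fin n) (Fin n) ℝ))
    (h𝒢 : 𝒢.Nonempty) (t t' : Matrix (Fin n) (Fin n) ℝ → ℝ) :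
    wasserstein1 (randomizationDist 𝒢 h𝒢 t) (randomizationDist 𝒢 h𝒢 t') ≤
      ENNReal.ofReal ((∑ G ∈ 𝒢, |t G - t' G|) / 𝒢.card) := by
  set π : Measure (ℝ × ℝ) :=
    ((PMF.uniformOfFinset 𝒢 h𝒢).map fun G => (t G, t' G)).toMeasure with hπ
  have h1 : π.map Prod.fst = randomizationDist 𝒢 h𝒢 t := by
    rw [hπ, PMF.toMeasure_map _ _ measurable_fst, PMF.map_comp]; rfl
  have h2 : π.map Prod.snd = randomizationDist 𝒢 h𝒢 t' := by
    rw [hπ, PMF.toMeasure_map _ _ measurable_snd, PMF.map_comp]; rfl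
  refine (iInf₂_le π ⟨h1, h2⟩).trans (le_of_eq ?_)
  have hcard : (0 : ℝ) < 𝒢.card := by exact_mod_cast h𝒢.card_pos
  rw [hπ, toMeasure_map_uniformOfFinset, lintegral_finsetSum_measure]
  have hm : Measurable fun z : ℝ × ℝ => ENNReal.ofReal |z.1 - z.2| :=
    ENNReal.measurable_ofReal.comp (measurable_fst.sub measurable_snd).abs
  simp only [lintegral_smul_measure, lintegral_dirac' _ hm, smul_eq_mul, ← Finset.mul_sum]
  rw [← ENNReal.ofReal_sum_of_nonneg fun _ _ => abs_nonneg _, div_eq_inv_mul,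
    ENNReal.ofReal_mul (inv_nonneg.2 hcard.le), ENNReal.ofReal_inv_of_pos hcard,
    ENNReal.ofReal_natCast]

/-! ### Deterministic bounds for the statistics and for the selected matrix -/

theorem abs_dotProduct_le {p : ℕ} (v w : Fin p → ℝ) : |v ⬝ᵥ w| ≤ ‖v‖ * l1 w := by
  rw [dotProduct, l1, Finset.mul_sum]
  refine (Finset.abs_sum_le_sum_abs _ _).trans (Finset.sum_le_sum fun i _ => ?_)
  rw [abs_mul]
  exact mul_le_mul_of_nonneg_right (norm_le_pi_norm v i) (abs_nonneg _)

theorem abs_apply_le_maxEntry {p : ℕ} (B : Matrix (Fin p) (Fin p) ℝ) (u v : Fin p) :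
    |B u v| ≤ maxEntry B :=
  le_ciSup (f := fun uv : Fin p × Fin p => |B uv.1 uv.2|) (Set.finite_range _).bddAbove (u, v)

theorem abs_dotProduct_mulVec_le {p : ℕ} (v w : Fin p → ℝ) (B : Matrix (Fin p) (Fin p) ℝ) :
    |v ⬝ᵥ (B *ᵥ w)| ≤ l1 v * maxEntry B * l1 w := by
  rw [dotProduct, l1, mul_assoc, Finset.sum_mul]
  refine (Finset.abs_sum_le_sum_abs _ _).trans (Finset.sum_le_sum fun u _ => ?_)
  rw [abs_mul]
  refine mul_le_mul_of_nonneg_left ?_ (abs_nonneg _)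
  rw [mulVec, dotProduct, l1, Finset.mul_sum]
  refine (Finset.abs_sum_le_sum_abs _ _).trans (Finset.sum_le_sum fun i _ => ?_)
  rw [abs_mul]
  exact mul_le_mul_of_nonneg_right (abs_apply_le_maxEntry B u i) (abs_nonneg _)

theorem maxEntry_nonneg {p : ℕ} (B : Matrix (Fin p) (Fin p) ℝ) : 0 ≤ maxEntry B :=
  Real.iSup_nonneg fun _ => abs_nonneg _

theorem l1_nonneg {p : ℕ} (v : Fin p → ℝ) : 0 ≤ l1 v := Finset.sum_nonneg fun _ _ => abs_nonneg _

theorem abs_oracleStat_sub_attainableStat_le {n p : ℕ} (hn : 0 < n)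
    (X : Matrix (Fin n) (Fin p) ℝ) (a β βhat : Fin p → ℝ) (ε : Fin n → ℝ)
    (M : Matrix (Fin p) (Fin p) ℝ) (G : Matrix (Fin n) (Fin n) ℝ) :
    |oracleStat X a β βhat ε M G - attainableStat X (X *ᵥ β + ε) a βhat M G| ≤
      √n * l1 (βhat - β) * (‖a ᵥ* (1 - M * gram X)‖ +
        l1 (a ᵥ* M) * maxEntry ((1 / (n : ℝ)) • (Xᵀ * G * X))) := by
  set Δ := βhat - β with hΔ
  have hn' : (0 : ℝ) < n := by exact_mod_cast hn
  have hs : 1 / √(n : ℝ) = √n * (1 / n) := by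
    rw [mul_one_div, Real.sqrt_div_self', one_div]
  have hres : X *ᵥ β + ε - X *ᵥ βhat = ε - X *ᵥ Δ := by
    rw [hΔ, mulVec_sub]; abel
  clear_value Δ
  have heq : oracleStat X a β βhat ε M G - attainableStat X (X *ᵥ β + ε) a βhat M G =
      √n * ((a ᵥ* (1 - M * gram X)) ⬝ᵥ Δ +
        (a ᵥ* M) ⬝ᵥ (((1 / (n : ℝ)) • (Xᵀ * G * X)) *ᵥ Δ)) := by
    have h1 : a ⬝ᵥ ((M * Xᵀ * G) *ᵥ (X *ᵥ Δ)) = (a ᵥ* M) ⬝ᵥ ((Xᵀ * G * X) *ᵥ Δ) := by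
      rw [mulVec_mulVec, ← dotProduct_mulVec, mulVec_mulVec]
      simp only [Matrix.mul_assoc]
    rw [oracleStat, attainableStat, hres, hs, ← hΔ, mulVec_sub _ ε, dotProduct_sub _ (_ *ᵥ ε), dotProduct_add,
      dotProduct_smul, smul_mulVec, dotProduct_smul, h1, dotProduct_mulVec a (1 - M * gram X)]
    simp only [smul_eq_mul]
    ring
  rw [heq, abs_mul, abs_of_nonneg (Real.sqrt_nonneg _), mul_assoc]
  refine mul_le_mul_of_nonneg_left ?_ (Real.sqrt_nonneg _)
  refine (abs_add_le _ _).trans ?_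
  have h1 := abs_dotProduct_le (a ᵥ* (1 - M * gram X)) Δ
  have h2 := abs_dotProduct_mulVec_le (a ᵥ* M) Δ ((1 / (n : ℝ)) • (Xᵀ * G * X))
  linarith

theorem wasserstein1_le_objective {n p : ℕ} (hn : 0 < n)
    (X : Matrix (Fin n) (Fin p) ℝ) (a β βhat : Fin p → ℝ) (ε : Fin n → ℝ)
    (M : Matrix (Fin p) (Fin p) ℝ) (𝒢 : Finset (Matrix (Fin n) (Fin n) ℝ)) (h𝒢 : 𝒢.Nonempty)
    {δ : ℝ} (hδ : 1 ≤ δ) :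
    wasserstein1 (randomizationDist 𝒢 h𝒢 (oracleStat X a β βhat ε M))
        (randomizationDist 𝒢 h𝒢 (attainableStat X (X *ᵥ β + ε) a βhat M)) ≤
      ENNReal.ofReal (√n * l1 (βhat - β) * objective X a 𝒢 δ M) := by
  refine (wasserstein1_randomizationDist_le 𝒢 h𝒢 _ _).trans (ENNReal.ofReal_le_ofReal ?_)
  have hcard : (0 : ℝ) < 𝒢.card := by exact_mod_cast h𝒢.card_pos
  have hnl : 0 ≤ √n * l1 (βhat - β) := mul_nonneg (Real.sqrt_nonneg _) (l1_nonneg _)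
  calc (∑ G ∈ 𝒢, |oracleStat X a β βhat ε M G - attainableStat X (X *ᵥ β + ε) a βhat M G|) /
        𝒢.card
      ≤ (∑ G ∈ 𝒢, √n * l1 (βhat - β) * (‖a ᵥ* (1 - M * gram X)‖ +
        l1 (a ᵥ* M) * maxEntry ((1 / (n : ℝ)) • (Xᵀ * G * X)))) / 𝒢.card := by
        gcongr with G _
        exact abs_oracleStat_sub_attainableStat_le hn X a β βhat ε M G
    _ = √n * l1 (βhat - β) * (‖a ᵥ* (1 - M * gram X)‖ +
        l1 (a ᵥ* M) / 𝒢.card * ∑ G ∈ 𝒢, maxEntry ((1 / (n : ℝ)) • (Xᵀ * G * X))) := by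
        rw [← Finset.mul_sum, Finset.sum_add_distrib, Finset.sum_const, nsmul_eq_mul,
          ← Finset.mul_sum]
        field_simp
    _ ≤ _ := by
        refine mul_le_mul_of_nonneg_left ?_ hnl
        unfold objective
        have := le_mul_of_one_le_left (norm_nonneg (a ᵥ* (1 - M * gram X))) hδ
        linarith

/-- Take λ to be the constraint value of M₀ itself: M₀ is then feasible, and M_λ has constraint
value and ℓ₁ norm no larger than those of M₀. -/
theorem IsSelected.objective_le {n p : ℕ} {X : Matrix (Fin n) (Fin p) ℝ} {a : Fin p → ℝ}
    {𝒢 : Finset (Matrix (Fin n) (Fin n) ℝ)} {δ : ℝ} (hδ : 0 ≤ δ)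
    {Mstar : Matrix (Fin p) (Fin p) ℝ} (h : IsSelected X a 𝒢 δ Mstar)
    (M₀ : Matrix (Fin p) (Fin p) ℝ) (h₀ : ‖a ᵥ* (1 - M₀ * gram X)‖ < 1) :
    objective X a 𝒢 δ Mstar ≤ objective X a 𝒢 δ M₀ := by
  obtain ⟨M, lamStar, hM, -, -, hmin, rfl⟩ := h
  set lam := ‖a ᵥ* (1 - M₀ * gram X)‖ with hlam
  have hmem : lam ∈ Set.Ico (0 : ℝ) 1 := ⟨norm_nonneg _, h₀⟩
  have hM₀ : M₀ ∈ feasible X a lam := le_refl lam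
  refine (hmin lam hmem ⟨M₀, hM₀⟩).trans ?_
  obtain ⟨hfeas, hopt⟩ := hM lam hmem ⟨M₀, hM₀⟩
  have h1 : ‖a ᵥ* (1 - M lam * gram X)‖ ≤ lam := hfeas
  unfold objective
  have h2 : (0 : ℝ) ≤ ∑ G ∈ 𝒢, maxEntry ((1 / (n : ℝ)) • (Xᵀ * G * X)) :=
    Finset.sum_nonneg fun _ _ => maxEntry_nonneg _
  gcongr
  exact hopt M₀ hM₀

theorem objective_le {n p : ℕ} {X : Matrix (Fin n) (Fin p) ℝ} {a : Fin p → ℝ}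
    {𝒢 : Finset (Matrix (Fin n) (Fin n) ℝ)} (h𝒢 : 𝒢.Nonempty) {δ r : ℝ} (hδ : 0 ≤ δ)
    {M : Matrix (Fin p) (Fin p) ℝ} (h₀ : ‖a ᵥ* (1 - M * gram X)‖ ≤ r)
    (hG : ∀ G ∈ 𝒢, maxEntry ((1 / (n : ℝ)) • (Xᵀ * G * X)) ≤ r) :
    objective X a 𝒢 δ M ≤ (δ + l1 (a ᵥ* M)) * r := by
  have hcard : (0 : ℝ) < 𝒢.card := by exact_mod_cast h𝒢.card_pos
  have h1 : ∑ G ∈ 𝒢, maxEntry ((1 / (n : ℝ)) • (Xᵀ * G * X)) ≤ 𝒢.card * r := by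
    refine (Finset.sum_le_sum hG).trans ?_
    rw [Finset.sum_const, nsmul_eq_mul]
  have h2 := l1_nonneg (a ᵥ* M)
  calc objective X a 𝒢 δ M ≤ δ * r + l1 (a ᵥ* M) / 𝒢.card * (𝒢.card * r) := by
        unfold objective; gcongr
    _ = _ := by field_simp

theorem vecMul_one_sub_mul_gram_apply {n p : ℕ} (hn : 0 < n) (X : Matrix (Fin n) (Fin p) ℝ)
    (a : Fin p → ℝ) (M : Matrix (Fin p) (Fin p) ℝ) (v : Fin p) :
    (a ᵥ* (1 - M * gram X)) v =
      -((1 / (n : ℝ)) * ∑ i, ((a ᵥ* M) ⬝ᵥ X i * X i v - a v)) := by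
  have hn' : (n : ℝ) ≠ 0 := by exact_mod_cast hn.ne'
  have h1 : a ᵥ* (M * (Xᵀ * X)) = (X *ᵥ (a ᵥ* M)) ᵥ* X := by
    rw [← vecMul_vecMul, ← vecMul_vecMul, vecMul_transpose]
  rw [gram, vecMul_sub, vecMul_one, Matrix.mul_smul, vecMul_smul, h1, Finset.sum_sub_distrib]
  simp only [Pi.sub_apply, Pi.smul_apply, smul_eq_mul, vecMul, dotProduct, mulVec,
    Finset.sum_const, Finset.card_univ, Fintype.card_fin, nsmul_eq_mul, mul_comm (X _ _)]
  field_simp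
  ring

/-! ### The good event -/

/-- The constant in the sample size condition. -/
noncomputable def sampleConstant (α : ℝ) : ℝ := 32 * 5 ^ (2 / α) * productFactor (2 / α)

theorem sampleConstant_pos (α : ℝ) : 0 < sampleConstant α := by
  have := productFactor_pos (2 / α)
  unfold sampleConstant
  positivity

/-- The designs for which one of the sample quantities deviates from its mean. -/
def deviationSet {n p : ℕ} (ν : Measure (Fin p → ℝ)) (a : Fin p → ℝ)
    (𝒢 : Finset (Matrix (Fin n) (Fin n) ℝ)) (V : ℝ) : Set (Fin n → Fin p → ℝ) :=
  (⋃ v ∈ (Finset.univ : Finset (Fin p)),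
    {x | 8 * (√2 * V) < |∑ i, ((a ᵥ* (covMatrix ν)⁻¹) ⬝ᵥ x i * x i v - a v)|}) ∪
  ⋃ G ∈ 𝒢, ⋃ uv ∈ (Finset.univ : Finset (Fin p × Fin p)),
    {x | 16 * V < |((of x)ᵀ * G * of x) uv.1 uv.2|}

theorem of_notMem_deviationSet {n p : ℕ} {ν : Measure (Fin p → ℝ)} {a : Fin p → ℝ}
    {𝒢 : Finset (Matrix (Fin n) (Fin n) ℝ)} {V : ℝ}
    {x : Fin n → Fin p → ℝ} (hx : x ∉ deviationSet ν a 𝒢 V) :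
    (∀ v, |∑ i, ((a ᵥ* (covMatrix ν)⁻¹) ⬝ᵥ x i * x i v - a v)| ≤ 8 * (√2 * V)) ∧
      ∀ G ∈ 𝒢, ∀ uv : Fin p × Fin p, |((of x)ᵀ * G * of x) uv.1 uv.2| ≤ 16 * V := by
  simpa only [deviationSet, Set.mem_union, Set.mem_iUnion, Set.mem_ofPred_eq, Finset.mem_univ,
    exists_prop, true_and, not_or, not_exists, not_and, not_lt] using hx

section

variable {n p : ℕ} {ν : Measure (Fin p → ℝ)} [IsProbabilityMeasure ν] {α : ℝ} {κ : ℝ≥0}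
  {a : Fin p → ℝ}

theorem SampleSizeCondition.tailCondition (hp : 0 < p) (hα : 0 < α) (hα2 : α ≤ 2)
    (hcov : CovariateCondition ν α κ)
    (hs : SampleSizeCondition n ν a α κ (sampleConstant α)) (hn : 1 ≤ n)
    (hL : 1 ≤ Real.log (p * n) + 2 * Real.log p) :
    TailCondition n (2 / α) (productFactor (2 / α) * (4 * kappaStar ν a κ)) (Gam ν a)
      (Real.log (p * n) + 2 * Real.log p)
      √(n * Gam ν a * (Real.log (p * n) + 2 * Real.log p) / 2) := by
  have hΓ := hcov.Gam_pos hp hα a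
  set Γ := Gam ν a
  set L := Real.log (p * n) + 2 * Real.log p with hLdef
  set q := 2 / α with hq
  have hq1 : 1 ≤ q := by rw [hq, le_div_iff₀ hα]; linarith
  have hn' : (1 : ℝ) ≤ n := by exact_mod_cast hn
  have hp' : (1 : ℝ) ≤ p := by exact_mod_cast hp
  have hκs : 0 ≤ kappaStar ν a κ := (sq_nonneg _).trans sq_le_kappaStar
  set l := Real.log (2 * n) with hl
  have hl0 : 0 < l := Real.log_pos (by linarith)
  -- The factor 3 inside the logarithmic term of the sample size condition.
  have hL3 : L ≤ 3 * Real.log (p * n) := by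
    have : Real.log p ≤ Real.log (p * n) :=
      Real.log_le_log (by linarith) (le_mul_of_one_le_right (by linarith) hn')
    linarith
  have hpf := productFactor_pos q
  refine ⟨hq1, by positivity, hn, hL, by positivity, ?_, ?_⟩
  · rw [Real.sq_sqrt (by positivity)]; ring
  · refine Real.le_sqrt_of_sq_le ?_
    -- The required bound is squared. As V² = nΓL/2, one power of L cancels, which leaves the
    -- exponent 4/α - 1.
    have h1 := (le_max_left _ _).trans_lt hs
    rw [div_lt_iff₀ hΓ, show 4 / α = 2 * q by rw [hq]; ring] at h1
    have h2 : L ^ (2 * q - 1) ≤ (3 * Real.log (p * n)) ^ (2 * q - 1) :=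
      Real.rpow_le_rpow (by linarith) hL3 (by linarith)
    have h3 : ∀ x : ℝ, 0 < x → (x ^ q) ^ 2 = x ^ (2 * q) := fun x hx => by
      rw [← Real.rpow_natCast, ← Real.rpow_mul hx.le]; congr 1; push_cast; ring
    have h4 : L ^ (2 * q - 1) * L = L ^ (2 * q) := by
      rw [← Real.rpow_add_one (by linarith), sub_add_cancel]
    have hcon : 8 * 5 ^ q * (productFactor q * (4 * kappaStar ν a κ)) * l ^ q * L ^ q =
        sampleConstant α * kappaStar ν a κ * l ^ q * L ^ q := by
      unfold sampleConstant; ring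
    rw [hcon, mul_pow, mul_pow, mul_pow, h3 l hl0, h3 L (by linarith), ← h4]
    have h5 : 4 * sampleConstant α ^ 2 * kappaStar ν a κ ^ 2 * l ^ (2 * q) * L ^ (2 * q - 1) ≤
        n * Γ := le_trans (by gcongr) h1.le
    have h6 : 0 ≤ sampleConstant α ^ 2 * kappaStar ν a κ ^ 2 * l ^ (2 * q) * L ^ (2 * q - 1) := by
      positivity
    nlinarith

theorem measureReal_deviationSet_lt (hp : 0 < p) (hα : 0 < α) (hcov : CovariateCondition ν α κ)
    {𝒢 : Finset (Matrix (Fin n) (Fin n) ℝ)} (h𝒢 : GroupCondition 𝒢) {L V : ℝ}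
    (hc : TailCondition n (2 / α) (productFactor (2 / α) * (4 * kappaStar ν a κ)) (Gam ν a) L V) :
    (Measure.pi fun _ : Fin n => ν).real (deviationSet ν a 𝒢 V) <
      p * (3 * Real.exp (-L)) + 𝒢.card * (p ^ 2 * (6 * Real.exp (-L))) := by
  have h1 : (Measure.pi fun _ : Fin n => ν).real (⋃ v ∈ (Finset.univ : Finset (Fin p)),
      {x | 8 * (√2 * V) < |∑ i, ((a ᵥ* (covMatrix ν)⁻¹) ⬝ᵥ x i * x i v - a v)|}) <
      p * (3 * Real.exp (-L)) := by
    refine (measureReal_biUnion_finset_le _ _).trans_lt ?_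
    have : Nonempty (Fin p) := ⟨⟨0, hp⟩⟩
    refine (Finset.sum_lt_sum_of_nonempty Finset.univ_nonempty fun v _ =>
      hc.measureReal_sum_rows_lt fun _ => hcov.isTailDominated_dotProduct hp hα a v).trans_eq ?_
    simp
  have h2 : (Measure.pi fun _ : Fin n => ν).real (⋃ G ∈ 𝒢,
      ⋃ uv ∈ (Finset.univ : Finset (Fin p × Fin p)),
      {x : Fin n → Fin p → ℝ | 16 * V < |((of x)ᵀ * G * of x) uv.1 uv.2|}) ≤
      𝒢.card * (p ^ 2 * (6 * Real.exp (-L))) := by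
    refine (measureReal_biUnion_finset_le _ _).trans ?_
    rw [← nsmul_eq_mul, ← Finset.sum_const]
    refine Finset.sum_le_sum fun G hG => (measureReal_biUnion_finset_le _ _).trans ?_
    refine (Finset.sum_le_sum (g := fun _ => 6 * Real.exp (-L)) fun uv _ => ?_).trans_eq ?_
    · rcases h𝒢.mem_permSet_or_mem_signSet hG with h | h
      · exact (hc.measureReal_perm_lt (fun u v => hcov.isTailDominated_prod hp hα a u v) h
          uv.1 uv.2).le
      · exact (hc.measureReal_sign_lt (fun u v => hcov.isTailDominated_entries hp hα a u v) h
          uv.1 uv.2).le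
    · simp [sq]
  exact (measureReal_union_le _ _).trans_lt (add_lt_add_of_lt_of_le h1 h2)

end

/-! ### The distance bound on the good event -/

theorem wasserstein1_le_of_notMem_deviationSet {n p : ℕ}
    {ν : Measure (Fin p → ℝ)} {a : Fin p → ℝ} (hn : 0 < n)
    {𝒢 : Finset (Matrix (Fin n) (Fin n) ℝ)} (h𝒢 : 𝒢.Nonempty) {L : ℝ} (hsize : 64 * Gam ν a * L < n) {δ : ℝ} (hδ : 1 ≤ δ)
    {X : Matrix (Fin n) (Fin p) ℝ}
    (hX : (X : Fin n → Fin p → ℝ) ∉ deviationSet ν a 𝒢 √(n * Gam ν a * L / 2))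
    (β βhat : Fin p → ℝ) (ε : Fin n → ℝ) {Mstar : Matrix (Fin p) (Fin p) ℝ}
    (hM : IsSelected X a 𝒢 δ Mstar) :
    wasserstein1 (randomizationDist 𝒢 h𝒢 (oracleStat X a β βhat ε Mstar))
        (randomizationDist 𝒢 h𝒢 (attainableStat X (X *ᵥ β + ε) a βhat Mstar)) ≤
      ENNReal.ofReal (l1 (βhat - β) * (8 * (δ + l1 (a ᵥ* (covMatrix ν)⁻¹)) *
        √(2 * Gam ν a * L))) := by
  have hn' : (0 : ℝ) < n := by exact_mod_cast hn
  set Γ := Gam ν a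
  set V := √(n * Γ * L / 2) with hV
  have hV0 : 0 ≤ V := Real.sqrt_nonneg _
  obtain ⟨hrow, hent⟩ := of_notMem_deviationSet hX
  have hs2 : √2 ≤ (2 : ℝ) := by rw [Real.sqrt_le_left (by norm_num)]; norm_num
  have hnorm : ‖a ᵥ* (1 - (covMatrix ν)⁻¹ * gram X)‖ ≤ 8 * (√2 * V) / n := by
    refine (pi_norm_le_iff_of_nonneg (by positivity)).2 fun v => ?_
    rw [vecMul_one_sub_mul_gram_apply hn, norm_neg, Real.norm_eq_abs, abs_mul,
      abs_of_pos (by positivity), one_div, inv_mul_eq_div]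
    gcongr
    exact hrow v
  -- The left side equals 8√(ΓL/n), so it is below 1 exactly when n > 64ΓL. The row sums therefore
  -- keep the threshold 8√2 V rather than the weaker 16 V.
  have hlt : 8 * (√2 * V) / n < 1 := by
    rw [div_lt_one hn', hV, ← Real.sqrt_mul (by norm_num),
      show 2 * (n * Γ * L / 2) = n * Γ * L by ring]
    have : √(n * Γ * L) < n / 8 := by
      rw [Real.sqrt_lt' (by positivity)]
      nlinarith
    linarith
  have hr : 8 * (√2 * V) / n ≤ 16 * V / n := by
    gcongr ?_ / _
    nlinarith
  have hmax : ∀ G ∈ 𝒢, maxEntry ((1 / (n : ℝ)) • (Xᵀ * G * X)) ≤ 16 * V / n := by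
    intro G hG
    refine Real.iSup_le (fun uv => ?_) (by positivity)
    rw [Matrix.smul_apply, smul_eq_mul, abs_mul, abs_of_pos (by positivity), one_div,
      inv_mul_eq_div]
    gcongr
    exact hent G hG uv
  refine (wasserstein1_le_objective hn X a β βhat ε Mstar 𝒢 h𝒢 hδ).trans
    (ENNReal.ofReal_le_ofReal ?_)
  have hobj := (hM.objective_le (by linarith) _ (hnorm.trans_lt hlt)).trans
    (objective_le h𝒢 (by linarith) (hnorm.trans hr) hmax)
  have hscale : √n * (16 * V / n) = 8 * √(2 * Γ * L) := by
    have h1 : V = √n * √(2 * Γ * L) / 2 := by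
      rw [hV, ← Real.sqrt_mul hn'.le, show (n * Γ * L / 2 : ℝ) = n * (2 * Γ * L) / 2 ^ 2 by ring,
        Real.sqrt_div' _ (by norm_num), Real.sqrt_sq (by norm_num)]
    have h2 : √(n : ℝ) * √n = n := Real.mul_self_sqrt hn'.le
    rw [h1, show √(n : ℝ) * (16 * (√n * √(2 * Γ * L) / 2) / n) =
      (√n * √n) * (8 * √(2 * Γ * L)) / n by ring, h2]
    field_simp
  calc √n * l1 (βhat - β) * objective X a 𝒢 δ Mstar
      ≤ √n * l1 (βhat - β) * ((δ + l1 (a ᵥ* (covMatrix ν)⁻¹)) * (16 * V / n)) :=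
        mul_le_mul_of_nonneg_left hobj (mul_nonneg (Real.sqrt_nonneg _) (l1_nonneg _))
    _ = l1 (βhat - β) * ((δ + l1 (a ᵥ* (covMatrix ν)⁻¹)) * (√n * (16 * V / n))) := by ring
    _ = _ := by rw [hscale]; ring

/-- A measurable set that avoids the preimage of `B`, of the expected probability. -/
theorem exists_measurableSet_avoiding {Ω E : Type*} [MeasurableSpace Ω] [MeasurableSpace E]
    {μ : Measure Ω} [IsProbabilityMeasure μ] {f : Ω → E} (hf : AEMeasurable f μ) (B : Set E) :
    ∃ A : Set Ω, MeasurableSet A ∧ μ.real A = 1 - (μ.map f).real B ∧ ∀ ω ∈ A, f ω ∉ B := by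
  -- The set B need not be measurable and f is only a.e. measurable, so a measurable hull is taken
  -- in E and again in Ω.
  refine ⟨(toMeasurable μ (f ⁻¹' toMeasurable (μ.map f) B))ᶜ,
    (measurableSet_toMeasurable _ _).compl, ?_, fun ω hω hB => hω ?_⟩
  · rw [probReal_compl_eq_one_sub (measurableSet_toMeasurable _ _), measureReal_def,
      measure_toMeasurable, ← Measure.map_apply_of_aemeasurable hf (measurableSet_toMeasurable _ _),
      measure_toMeasurable, measureReal_def]
  · exact subset_toMeasurable _ _ (subset_toMeasurable (μ.map f) B hB)

end ResidualRandomization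

theorem mainTheorem2 :
    ∃ C : ℝ → ℝ, (∀ α, 0 < C α) ∧
      ∀ (α : ℝ) (_ : 0 < α) (_ : α ≤ 2) (n p : ℕ) (_ : 0 < p)
        (Ω : Type*) (_ : MeasurableSpace Ω) (μ : Measure Ω) (_ : IsProbabilityMeasure μ)
        (ν : Measure (Fin p → ℝ)) (X : Ω → Matrix (Fin n) (Fin p) ℝ)
        (_ : iIndepFun (fun (i : Fin n) (ω : Ω) => X ω i) μ)
        (_ : ∀ i, HasLaw (fun ω => X ω i) ν μ)
        (κ : ℝ≥0) (_ : ResidualRandomization.CovariateCondition ν α κ)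
        (a : Fin p → ℝ)
        (_ : ResidualRandomization.SampleSizeCondition n ν a α κ (C α))
        (𝒢 : Finset (Matrix (Fin n) (Fin n) ℝ)) (h𝒢 : 𝒢.Nonempty)
        (_ : ResidualRandomization.GroupCondition 𝒢)
        (δ : ℝ) (_ : 1 ≤ δ)
        (β : Fin p → ℝ) (ε Y : Ω → Fin n → ℝ) (_ : ∀ ω, Y ω = X ω *ᵥ β + ε ω)
        (βhat : Ω → Fin p → ℝ),
        ∃ A : Set Ω, MeasurableSet A ∧
          μ.real A > 1 - 3 / ((n : ℝ) * p) - 6 * (𝒢.card : ℝ) / ((n : ℝ) * p) ∧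
          ∀ ω ∈ A, ∀ Mstar : Matrix (Fin p) (Fin p) ℝ,
            ResidualRandomization.IsSelected (X ω) a 𝒢 δ Mstar →
            ResidualRandomization.wasserstein1
              (ResidualRandomization.randomizationDist 𝒢 h𝒢
                (ResidualRandomization.oracleStat (X ω) a β (βhat ω) (ε ω) Mstar))
              (ResidualRandomization.randomizationDist 𝒢 h𝒢
                (ResidualRandomization.attainableStat (X ω) (Y ω) a (βhat ω) Mstar)) ≤
            ENNReal.ofReal (ResidualRandomization.l1 (βhat ω - β) *
              (8 * (δ + ResidualRandomization.l1
                  (a ᵥ* (ResidualRandomization.covMatrix ν)⁻¹)) *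
                √(2 * ResidualRandomization.Gam ν a *
                  (Real.log (p * n) + 2 * Real.log p)))) := by
  refine ⟨ResidualRandomization.sampleConstant, ResidualRandomization.sampleConstant_pos, ?_⟩
  intro α hα hα2 n p hp Ω _ μ _ ν X hind hlaw κ hcov a hsize 𝒢 h𝒢 hgroup δ hδ β ε Y hY βhat
  have hp' : (1 : ℝ) ≤ p := by exact_mod_cast hp
  have hn : 0 < n := by
    rcases Nat.eq_zero_or_pos n with rfl | hn
    · exfalso
      have h1 := (le_max_right _ _).trans_lt hsize
      have hG : 0 ≤ ResidualRandomization.Gam ν a :=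
        le_trans (Real.iSup_nonneg fun _ => integral_nonneg fun _ => sq_nonneg _)
          (le_max_right _ _)
      have hlog := Real.log_nonneg hp'
      have : 0 ≤ 64 * ResidualRandomization.Gam ν a *
          (Real.log (p * (0 : ℕ)) + 2 * Real.log p) := by
        -- For n = 0 the convention log 0 = 0 makes the second threshold nonnegative, so the strict
        -- sample size condition fails.
        simp only [Nat.cast_zero, mul_zero, Real.log_zero]
        positivity
      simp only [Nat.cast_zero] at h1 this
      linarith
    · exact hn
  have hn' : (1 : ℝ) ≤ n := by exact_mod_cast hn
  have hν : IsProbabilityMeasure ν := by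
    rw [← (hlaw ⟨0, hn⟩).map_eq]
    exact Measure.isProbabilityMeasure_map (hlaw ⟨0, hn⟩).aemeasurable
  have hnp : (0 : ℝ) < n * p := by positivity
  -- If np < 3 the probability bound is negative and the empty event will do. Otherwise np ≥ 3 > e
  -- gives L ≥ 1, as the Bernstein inequality requires.
  by_cases hsmall : (n : ℝ) * p < 3
  · refine ⟨∅, MeasurableSet.empty, ?_, fun ω hω => hω.elim⟩
    have h1 : 1 < 3 / ((n : ℝ) * p) := (one_lt_div hnp).2 hsmall
    have h2 : 0 ≤ 6 * (𝒢.card : ℝ) / ((n : ℝ) * p) := by positivity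
    simp only [measureReal_empty]
    linarith
  set L := Real.log (p * n) + 2 * Real.log p with hL
  have hL1 : 1 ≤ L := by
    have h1 : Real.log (Real.exp 1) ≤ Real.log (p * n) :=
      Real.log_le_log (Real.exp_pos 1) (by linarith [Real.exp_one_lt_d9])
    rw [Real.log_exp] at h1
    linarith [Real.log_nonneg hp']
  have hexp : Real.exp (-L) = 1 / (n * p * p ^ 2) := by
    rw [Real.exp_neg, hL, Real.exp_add, Real.exp_log (by positivity),
      show 2 * Real.log p = ((2 : ℕ) : ℝ) * Real.log p by norm_num, Real.exp_nat_mul,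
      Real.exp_log (by linarith), one_div, mul_comm (p : ℝ) n]
  have hc := hsize.tailCondition hp hα hα2 hcov hn hL1
  have hXm : AEMeasurable (fun ω (i : Fin n) => X ω i) μ :=
    aemeasurable_pi_lambda _ fun i => (hlaw i).aemeasurable
  have hmap : μ.map (fun ω (i : Fin n) => X ω i) = Measure.pi fun _ => ν := by
    rw [(iIndepFun_iff_map_fun_eq_pi_map fun i => (hlaw i).aemeasurable).1 hind]
    congr 1
    funext i
    exact (hlaw i).map_eq
  obtain ⟨A, hA, hμA, hAB⟩ := ResidualRandomization.exists_measurableSet_avoiding hXm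
    (ResidualRandomization.deviationSet ν a 𝒢 √(n * ResidualRandomization.Gam ν a * L / 2))
  refine ⟨A, hA, ?_, fun ω hω Mstar hM => ?_⟩
  · have hdev := ResidualRandomization.measureReal_deviationSet_lt hp hα hcov hgroup hc
    rw [hmap] at hμA
    have h1 : p * (3 * Real.exp (-L)) ≤ 3 / ((n : ℝ) * p) := by
      rw [hexp, mul_one_div, mul_div_assoc', div_le_div_iff₀ (by positivity) hnp]
      have : (n * p : ℝ) * p ≤ n * p * p ^ 2 := by gcongr; nlinarith
      linarith
    have h2 : 𝒢.card * (p ^ 2 * (6 * Real.exp (-L))) = 6 * (𝒢.card : ℝ) / ((n : ℝ) * p) := by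
      rw [hexp]; field_simp
    linarith
  · rw [hY ω]
    exact ResidualRandomization.wasserstein1_le_of_notMem_deviationSet hn h𝒢
      ((le_max_right _ _).trans_lt hsize) hδ (hAB ω hω) β (βhat ω) (ε ω) hM
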